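/- **Theorem.** An instance of Exact-Simultaneous-Dipaths with $k$ colors consists of a finite digraph $D=(V,A)$ (parallel arcs allowed), color classes $A_1,\dots,A_k\subseteq A$ with $A=A_1\cup\dots\cup A_k$, two distinct vertices $s,t\in V$, and a conservative cost function $c\colon A\to\mathbb R$ (i.e. no directed cycle has negative cost). A *feasible solution* is a set $A'\subseteq A$ such that $A'\cap A_i$ is (the arc set of) an $s$-$t$ dipath for every $i\in\{1,\dots,k\}$; its cost is $c(A')=\sum_{a\in A'}c(a)$. The task is to find a feasible solution of minimum cost, or to report that there is no feasible solution. For every fixed integer $k\ge 1$ the following hold. 1. There are an algorithm and a polynomial $p$ such that, on every instance with $k$ colors whose digraph $D$ is acyclic, the algorithm halts after at most $p(|V|+|A|)$ elementary steps, reports whether a feasible solution exists, and, if one exists, outputs a feasible solution of minimum cost. Here an algorithm is a program of a random access machine whose elementary steps are reading and writing registers, additions, (truncated) subtractions and comparisons of natural numbers, and additions, subtractions and comparisons of real numbers; the only real constant in the program is $0$. 2. For an instance with $D$ acyclic, let $\widetilde D$ be the digraph with vertex set $V^k$ that has, for each arc $a=xy\in A$, an arc from $(u_1,\dots,u_k)$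 to $(v_1,\dots,v_k)$ of cost $c(a)$ whenever $u_i=x$ and $v_i=y$ for all $i$ with $a\in A_i$, and $u_j=v_j$ for all $j$ with $a\notin A_j$; this arc is said to be *added for* $a$. Then: * for every dipath $\widetilde P$ of $\widetilde D$ from $(s,\dots,s)$ to $(t,\dots,t)$, the set of the arcs of $D$ for which the arcs of $\widetilde P$ were added is a feasible solution, and its cost is equal to that of $\widetilde P$; * every feasible solution arises in this way from some dipath of $\widetilde D$ from $(s,\dots,s)$ to $(t,\dots,t)$ of the same cost. In particular, for every $\gamma\in\mathbb R$ there is a feasible solution of cost $\gamma$ if and only if $\widetilde D$ contains a dipath from $(s,\dots,s)$ to $(t,\dots,t)$ of cost $\gamma$. -/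

import Mathlib

/-! ## Digraphs, dipaths, dicycles -/

/-- A digraph with vertex set `V` and arc set `A`; parallel arcs are allowed. -/
structure MultiDigraph (V A : Type*) where
  tail : A → V
  head : A → V

namespace MultiDigraph

variable {V A : Type*} (D : MultiDigraph V A)

/-- `D.IsWalk u l v`: the list `l` of arcs is a directed walk from `u` to `v`. -/
def IsWalk : V → List A → V → Prop
  | u, [], v => u = v
  | u, a :: l, v => D.tail a = u ∧ IsWalk (D.head a) l v

/-- `D.IsDipath u l v`: the list `l` is the arc sequence of a dipath from `u` to `v`, i.e. of a
directed walk that visits no vertex twice. -/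
def IsDipath (u : V) (l : List A) (v : V) : Prop :=
  D.IsWalk u l v ∧ (u :: l.map D.head).Nodup

/-- `D.IsDicycle l`: the list `l` is the arc sequence of a directed cycle: a nonempty closed
directed walk that visits no vertex twice, except that it returns to its start. -/
def IsDicycle (l : List A) : Prop :=
  l ≠ [] ∧ (∃ v, D.IsWalk v l v) ∧ (l.map D.head).Nodup

/-- `D` is a directed acyclic graph. -/
def IsAcyclic : Prop := ∀ l, ¬ D.IsDicycle l

/-- The cost function `c` is conservative: there is no directed cycle of negative cost. -/
def IsConservative (c : A → ℝ) : Prop := ∀ l, D.IsDicycle l → 0 ≤ (l.map c).sum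

end MultiDigraph

/-! ## The problem Exact-Simultaneous-Dipaths -/

/-- An instance of Exact-Simultaneous-Dipaths with `k` colors. -/
structure ExactSimDipaths (k : ℕ) (V A : Type*) where
  D : MultiDigraph V A
  color : Fin k → Finset A
  covers : ∀ a, ∃ i, a ∈ color i
  s : V
  t : V
  s_ne_t : s ≠ t
  c : A → ℝ
  conservative : D.IsConservative c

namespace ExactSimDipaths

variable {k : ℕ} {V A : Type*} (I : ExactSimDipaths k V A)

/-- `A'` is a feasible solution: `A' ∩ A_i` is (the arc set of) an `s`-`t` dipath for every
color `i`. -/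
def IsFeasible (A' : Finset A) : Prop :=
  ∀ i, ∃ l : List A, I.D.IsDipath I.s l I.t ∧ ∀ a, a ∈ l ↔ a ∈ A' ∧ a ∈ I.color i

/-- The cost of a set of arcs. -/
def cost (A' : Finset A) : ℝ := ∑ a ∈ A', I.c a

/-- `A'` is a feasible solution of minimum cost. -/
def IsOptimal (A' : Finset A) : Prop :=
  I.IsFeasible A' ∧ ∀ B, I.IsFeasible B → I.cost A' ≤ I.cost B

/-! ### The auxiliary digraph on `k`-tuples of vertices -/

/-- An arc of the auxiliary digraph: it goes from the tuple `src` to the tuple `dst` and was added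
for the arc `arc` of the original digraph. -/
structure AuxArc where
  arc : A
  src : Fin k → V
  dst : Fin k → V
  moved : ∀ i, arc ∈ I.color i → src i = I.D.tail arc ∧ dst i = I.D.head arc
  fixed : ∀ i, arc ∉ I.color i → src i = dst i

/-- The auxiliary digraph. -/
def aux : MultiDigraph (Fin k → V) I.AuxArc where
  tail e := e.src
  head e := e.dst

/-- The cost of a list of arcs of the auxiliary digraph: each of them costs as much as the arc of
the original digraph that it was added for. -/
def auxCost (P : List I.AuxArc) : ℝ := (P.map fun e => I.c e.arc).sum

/-- `P` is a dipath of the auxiliary digraph from `(s, …, s)` to `(t, …, t)`. -/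
def IsAuxDipath (P : List I.AuxArc) : Prop :=
  I.aux.IsDipath (fun _ => I.s) P (fun _ => I.t)

/-- `A'` is the set of the original arcs for which the arcs in `P` were added. -/
def Corresponds (P : List I.AuxArc) (A' : Finset A) : Prop :=
  ∀ a, a ∈ A' ↔ ∃ e ∈ P, e.arc = a

end ExactSimDipaths

/-! ## The machine model

A random access machine, programmed by structured programs. Its memory consists of banks of
registers; a register of a bank is addressed by a computed index. There are registers for natural
numbers and registers for real numbers. Natural numbers can be added, subtracted (with
truncation at 0) and compared. Real numbers can only be added, subtracted and compared, and the
only real constant in a program is `0`. Every operation takes one step.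

There is no multiplication, so `T` steps can lengthen the binary representation of a number by
`O(T)` bits only. On rational inputs, a polynomial number of these steps is therefore polynomial
time on a Turing machine. -/

namespace RAM

/-- A memory state: `num b j` is the content of register `j` in the number bank `b`,
and `real b j` the content of register `j` in the real bank `b`. -/
structure State where
  num : ℕ → ℕ → ℕ
  real : ℕ → ℕ → ℝ

/-- Expressions with natural number values. -/
inductive NExp where
  | lit (n : ℕ)
  | get (bank : ℕ) (idx : NExp)
  | add (x y : NExp)
  | sub (x y : NExp)

/-- Expressions with real values. -/
inductive RExp where
  | zero
  | get (bank : ℕ) (idx : NExp)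
  | add (x y : RExp)
  | sub (x y : RExp)

/-- Tests. -/
inductive Test where
  | nlt (x y : NExp)
  | rlt (x y : RExp)
  | not (b : Test)
  | and (b c : Test)

/-- Programs. -/
inductive Program where
  | skip
  | setN (bank : ℕ) (idx : NExp) (val : NExp)
  | setR (bank : ℕ) (idx : NExp) (val : RExp)
  | seq (p q : Program)
  | ite (b : Test) (p q : Program)
  | loop (b : Test) (p : Program)

def NExp.eval (σ : State) : NExp → ℕ
  | lit n => n
  | get b i => σ.num b (i.eval σ)
  | add x y => x.eval σ + y.eval σ
  | sub x y => x.eval σ - y.eval σ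

noncomputable def RExp.eval (σ : State) : RExp → ℝ
  | zero => 0
  | get b i => σ.real b (i.eval σ)
  | add x y => x.eval σ + y.eval σ
  | sub x y => x.eval σ - y.eval σ

def Test.holds (σ : State) : Test → Prop
  | nlt x y => x.eval σ < y.eval σ
  | rlt x y => x.eval σ < y.eval σ
  | not b => ¬ b.holds σ
  | and b c => b.holds σ ∧ c.holds σ

/-- The number of steps to evaluate an expression. -/
def NExp.steps : NExp → ℕ
  | lit _ => 1
  | get _ i => i.steps + 1
  | add x y => x.steps + y.steps + 1
  | sub x y => x.steps + y.steps + 1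

def RExp.steps : RExp → ℕ
  | zero => 1
  | get _ i => i.steps + 1
  | add x y => x.steps + y.steps + 1
  | sub x y => x.steps + y.steps + 1

def Test.steps : Test → ℕ
  | nlt x y => x.steps + y.steps + 1
  | rlt x y => x.steps + y.steps + 1
  | not b => b.steps + 1
  | and b c => b.steps + c.steps + 1

/-- Write the number `v` into register `j` of the number bank `b`. -/
def State.writeN (σ : State) (b j v : ℕ) : State :=
  { σ with num := Function.update σ.num b (Function.update (σ.num b) j v) }

/-- Write the real `v` into register `j` of the real bank `b`. -/
noncomputable def State.writeR (σ : State) (b j : ℕ) (v : ℝ) : State :=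
  { σ with real := Function.update σ.real b (Function.update (σ.real b) j v) }

/-- `Runs p σ T τ`: started in state `σ`, the program `p` halts after exactly `T` steps,
in state `τ`. -/
inductive Runs : Program → State → ℕ → State → Prop
  | skip (σ) : Runs .skip σ 1 σ
  | setN (σ b i v) :
      Runs (.setN b i v) σ (i.steps + v.steps + 1) (σ.writeN b (i.eval σ) (v.eval σ))
  | setR (σ b i v) :
      Runs (.setR b i v) σ (i.steps + v.steps + 1) (σ.writeR b (i.eval σ) (v.eval σ))
  | seq {p q σ₁ σ₂ σ₃ T₁ T₂} (hp : Runs p σ₁ T₁ σ₂) (hq : Runs q σ₂ T₂ σ₃) :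
      Runs (.seq p q) σ₁ (T₁ + T₂) σ₃
  | iteTrue {b p q σ τ T} (hb : b.holds σ) (hp : Runs p σ T τ) :
      Runs (.ite b p q) σ (b.steps + T) τ
  | iteFalse {b p q σ τ T} (hb : ¬ b.holds σ) (hq : Runs q σ T τ) :
      Runs (.ite b p q) σ (b.steps + T) τ
  | loopTrue {b p σ₁ σ₂ σ₃ T₁ T₂} (hb : b.holds σ₁) (hp : Runs p σ₁ T₁ σ₂)
      (hl : Runs (.loop b p) σ₂ T₂ σ₃) : Runs (.loop b p) σ₁ (b.steps + T₁ + T₂) σ₃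
  | loopFalse {b p σ} (hb : ¬ b.holds σ) : Runs (.loop b p) σ b.steps σ

end RAM

/-! ## Input and output of an algorithm for the problem -/

namespace ExactSimDipaths

variable {k n m : ℕ} (I : ExactSimDipaths k (Fin n) (Fin m))

/-- The initial memory for an instance with `n` vertices and `m` arcs. Number bank 0 holds `n`, `m`,
`s`, `t`; bank 1 the tails of the arcs; bank 2 their heads; register `a * k + i` of bank 3
tells by `1` or `0` whether the arc `a` has the color `i`. Real bank 0 holds the costs of the arcs.
All other registers are `0`. -/
noncomputable def input : RAM.State where
  num
    | 0, 0 => n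
    | 0, 1 => m
    | 0, 2 => I.s
    | 0, 3 => I.t
    | 1, j => if h : j < m then I.D.tail ⟨j, h⟩ else 0
    | 2, j => if h : j < m then I.D.head ⟨j, h⟩ else 0
    | 3, j => if ∃ (a : Fin m) (i : Fin k), j = a * k + i ∧ a ∈ I.color i then 1 else 0
    | _, _ => 0
  real
    | 0, j => if h : j < m then I.c ⟨j, h⟩ else 0
    | _, _ => 0

/-- The set of arcs that a final memory state describes: `a` belongs to it if and only if
register `a` of number bank 5 holds `1`. -/
def output (m : ℕ) (τ : RAM.State) : Finset (Fin m) :=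
  Finset.univ.filter fun a => τ.num 5 a = 1

/-- The final memory state `τ` is a correct answer for the instance: register 0 of number bank 4
tells by `1` or `0` whether a feasible solution exists, and if so, the set of arcs described by
`τ` is a feasible solution of minimum cost. -/
def IsSolvedBy (τ : RAM.State) : Prop :=
  ((∃ A', I.IsFeasible A') → τ.num 4 0 = 1 ∧ I.IsOptimal (output m τ)) ∧
  ((¬ ∃ A', I.IsFeasible A') → τ.num 4 0 = 0)

end ExactSimDipaths

/-!
Let `D` be acyclic. A walk of the auxiliary digraph projects, for each color `i`, to a walk of `D`
in coordinate `i`, whose arcs are those of color `i` that the walk was built from. In an acyclic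
digraph walks are dipaths, so no arc is used twice, the arcs used form a feasible solution when the
walk leads from `(s, …, s)` to `(t, …, t)`, and the costs agree (`isWalk_proj`,
`exists_feasible_of_isWalk`). Conversely, the vertices of `D` have a ranking that increases along
the arcs. If the arcs of a feasible solution are sorted by the rank of their tails, then the arcs of
each color appear in the order of their dipath, so that in this order they move `(s, …, s)` to
`(t, …, t)` in the auxiliary digraph (`exists_isWalk_of_feasible`).

A feasible solution of minimum cost is therefore given by a walk of minimum cost in the auxiliary
digraph, which the program `RAM.solve` finds by the method of Bellman and Ford: the walks use at
most `m` arcs (`length_le_of_isWalk`), so `m` rounds, in each of which every arc is relaxed in each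
of the `n ^ k` states, suffice. A tuple of vertices is numbered by the value of its entries as digits
to the base `n`; as the machine cannot multiply, this number is computed from tables of multiples of
the powers of `n`. Each reached state keeps the entries of its tuple, the cost of the best known walk
to it, and the arcs of this walk as a bit mask, which needs no more than `m` bits and can be extended
by an arc with one addition. The invariant `Sound` says that the stored data come from walks; it and
the completeness of the search are maintained by each relaxation (`exec_relax`, `SearchInv`). Time
bounds are carried along in the Hoare triples `RAM.Triple` and are polynomials in `n` and `m` for
fixed `k`.
-/

/-! ### Closed walks and acyclic digraphs -/

namespace MultiDigraph

variable {V A : Type*} {D : MultiDigraph V A}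

theorem isWalk_append {u v : V} {l₁ l₂ : List A} :
    D.IsWalk u (l₁ ++ l₂) v ↔ ∃ w, D.IsWalk u l₁ w ∧ D.IsWalk w l₂ v := by
  induction l₁ generalizing u with
  | nil => simp [IsWalk]
  | cons a l ih => simp [IsWalk, ih, and_assoc]

/-- The part of a walk between two visits to the same vertex is a closed walk. -/
theorem IsWalk.nodup_of_no_closed {N : ℕ}
    (h : ∀ v l, D.IsWalk v l v → l.length ≤ N → l = []) {u v : V} {l : List A}
    (hl : D.IsWalk u l v) (hN : l.length ≤ N) : (u :: l.map D.head).Nodup := by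
  induction l generalizing u with
  | nil => simp
  | cons a l ih =>
    rw [List.nodup_cons]
    refine ⟨fun hu => ?_, ?_⟩
    · obtain ⟨b, hb, rfl⟩ := List.mem_map.1 hu
      obtain ⟨l₁, l₂, hs⟩ := List.append_of_mem hb
      rw [hs, List.append_cons] at hl
      obtain ⟨w, hw, -⟩ := isWalk_append.1 hl
      obtain ⟨x, hx, hx'⟩ := isWalk_append.1 hw
      have hlen := congrArg List.length hs
      simp only [List.length_cons, List.length_append] at hlen hN
      have hw' : w = D.head b := by simpa [IsWalk, eq_comm] using hx'.2
      have := h _ _ (hw' ▸ hw) (by simp; omega)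
      simp at this
    · simpa using ih hl.2 (by simp at hN; omega)

theorem IsAcyclic.closed_eq_nil (hD : D.IsAcyclic) (v : V) (l : List A) (hl : D.IsWalk v l v) :
    l = [] := by
  -- a shortest nonempty closed walk would be a dicycle
  induction hn : l.length using Nat.strong_induction_on generalizing v l with
  | _ n ih =>
    cases l with
    | nil => rfl
    | cons a l =>
      refine absurd ⟨List.cons_ne_nil a l, ⟨v, hl⟩, ?_⟩ (hD (a :: l))
      simp only [List.length_cons] at hn
      exact IsWalk.nodup_of_no_closed (N := l.length)
        (fun w l' hw hN => ih l'.length (by omega) w l' hw rfl) hl.2 le_rfl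

theorem isDipath_of_no_closed (h : ∀ v l, D.IsWalk v l v → l = []) {u v : V} {l : List A}
    (hl : D.IsWalk u l v) : D.IsDipath u l v :=
  ⟨hl, hl.nodup_of_no_closed (fun w l' hw _ => h w l' hw) le_rfl⟩

/-- An acyclic digraph has a ranking of its vertices that increases along each arc: a vertex is
ranked by the number of vertices from which it can be reached by a nonempty walk. -/
theorem IsAcyclic.exists_rank [Finite V] (hD : D.IsAcyclic) :
    ∃ r : V → ℕ, ∀ a, r (D.tail a) < r (D.head a) := by
  refine ⟨fun v => {w | ∃ l, l ≠ [] ∧ D.IsWalk w l v}.ncard, fun a => Set.ncard_lt_ncard ?_⟩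
  refine (Set.ssubset_iff_of_subset ?_).2 ⟨D.tail a, ⟨[a], by simp [IsWalk]⟩, ?_⟩
  · rintro w ⟨l, -, hl⟩
    exact ⟨l ++ [a], by simp, isWalk_append.2 ⟨_, hl, by simp [IsWalk]⟩⟩
  · rintro ⟨l, hne, hl⟩
    exact hne (hD.closed_eq_nil _ _ hl)

theorem IsWalk.pairwise_rank {r : V → ℕ} (hr : ∀ a, r (D.tail a) < r (D.head a)) {u v : V}
    {l : List A} (hl : D.IsWalk u l v) :
    (∀ a ∈ l, r u ≤ r (D.tail a)) ∧ l.Pairwise fun a b => r (D.tail a) < r (D.tail b) := by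
  induction l generalizing u with
  | nil => simp
  | cons a l ih =>
    obtain ⟨rfl, hl⟩ := hl
    obtain ⟨h1, h2⟩ := ih hl
    refine ⟨?_, List.pairwise_cons.2 ⟨fun b hb => (hr a).trans_le (h1 b hb), h2⟩⟩
    intro b hb
    rcases List.mem_cons.1 hb with rfl | hb
    · exact le_rfl
    · exact (hr a).le.trans (h1 b hb)

end MultiDigraph

/-! ### Walks of the auxiliary digraph and feasible solutions -/

namespace ExactSimDipaths

variable {k : ℕ} {V A : Type*} {I : ExactSimDipaths k V A}

open Classical in
/-- The arcs of color `i` that a walk of the auxiliary digraph was built from form a walk between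
the `i`-th coordinates of its ends. -/
theorem isWalk_proj (i : Fin k) {u v : Fin k → V} {P : List I.AuxArc} (hP : I.aux.IsWalk u P v) :
    I.D.IsWalk (u i) ((P.map AuxArc.arc).filter (· ∈ I.color i)) (v i) := by
  induction P generalizing u with
  | nil => exact congrFun hP i
  | cons e P ih =>
    obtain ⟨rfl, hP⟩ := hP
    have := ih hP
    by_cases he : e.arc ∈ I.color i
    · obtain ⟨h1, h2⟩ := e.moved i he
      simp only [List.map_cons, List.filter_cons, he, decide_true, if_true]
      exact ⟨h1.symm, h2 ▸ this⟩
    · have h1 := e.fixed i he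
      simp only [List.map_cons, List.filter_cons, he, decide_false, Bool.false_eq_true, if_false]
      exact (show I.aux.tail e i = I.aux.head e i from h1) ▸ this

theorem aux_closed_eq_nil (hD : I.D.IsAcyclic) (u : Fin k → V) (P : List I.AuxArc)
    (hP : I.aux.IsWalk u P u) : P = [] := by
  classical
  cases P with
  | nil => rfl
  | cons e P =>
    obtain ⟨i, hi⟩ := I.covers e.arc
    simpa [hi] using hD.closed_eq_nil _ _ (isWalk_proj i hP)

/-- No arc is used twice by a walk of the auxiliary digraph, because its projection to a color of
the arc would use it twice. -/
theorem nodup_arc_of_isWalk (hD : I.D.IsAcyclic) {u v : Fin k → V} {P : List I.AuxArc}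
    (hP : I.aux.IsWalk u P v) : (P.map AuxArc.arc).Nodup := by
  classical
  rw [List.nodup_iff_count_le_one]
  intro a
  obtain ⟨i, hi⟩ := I.covers a
  have h := (MultiDigraph.isDipath_of_no_closed hD.closed_eq_nil (isWalk_proj i hP)).2
  have h' := List.nodup_iff_count_le_one.1 (List.nodup_cons.1 h).2.of_map a
  rwa [List.count_filter (by simpa using hi)] at h'

theorem length_le_of_isWalk {m : ℕ} {I : ExactSimDipaths k V (Fin m)} (hD : I.D.IsAcyclic)
    {u v : Fin k → V} {P : List I.AuxArc} (hP : I.aux.IsWalk u P v) : P.length ≤ m := by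
  simpa using (nodup_arc_of_isWalk hD hP).length_le_card

theorem exists_feasible_of_isWalk (hD : I.D.IsAcyclic) {P : List I.AuxArc}
    (hP : I.aux.IsWalk (fun _ => I.s) P (fun _ => I.t)) :
    ∃ A', I.Corresponds P A' ∧ I.IsFeasible A' ∧ I.cost A' = I.auxCost P := by
  classical
  refine ⟨(P.map AuxArc.arc).toFinset, fun a => by simp, fun i => ?_, ?_⟩
  · exact ⟨_, MultiDigraph.isDipath_of_no_closed hD.closed_eq_nil (isWalk_proj i hP),
      fun a => by simp⟩
  · rw [cost, List.sum_toFinset _ (nodup_arc_of_isWalk hD hP), auxCost, List.map_map]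
    rfl

open Classical in
theorem exists_isWalk_of_proj {u v : Fin k → V} {l : List A}
    (h : ∀ i, I.D.IsWalk (u i) (l.filter (· ∈ I.color i)) (v i)) :
    ∃ P, I.aux.IsWalk u P v ∧ P.map AuxArc.arc = l := by
  induction l generalizing u with
  | nil => exact ⟨[], funext h, rfl⟩
  | cons a l ih =>
    obtain ⟨P, hP, rfl⟩ := ih (u := fun i => if a ∈ I.color i then I.D.head a else u i) fun i => by
      have := h i
      by_cases ha : a ∈ I.color i
      · simp only [List.filter_cons, ha, decide_true, if_true] at this ⊢
        exact this.2
      · simpa [List.filter_cons, ha] using this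
    let e : I.AuxArc :=
      { arc := a
        src := u
        dst := fun i => if a ∈ I.color i then I.D.head a else u i
        moved := fun i ha => by
          have := h i
          simp only [List.filter_cons, ha, decide_true, if_true] at this
          exact ⟨this.1.symm, if_pos ha⟩
        fixed := fun i ha => by simp [ha] }
    exact ⟨e :: P, ⟨rfl, hP⟩, rfl⟩

/-- Sorting the arcs of a feasible solution along a ranking of the vertices lists the arcs of each
color in the order of their dipath. -/
theorem exists_isWalk_of_feasible [Finite V] (hD : I.D.IsAcyclic) {A' : Finset A}
    (hA : I.IsFeasible A') : ∃ P, I.aux.IsWalk (fun _ => I.s) P (fun _ => I.t) ∧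
      I.Corresponds P A' ∧ I.auxCost P = I.cost A' := by
  classical
  obtain ⟨r, hr⟩ := hD.exists_rank
  let le : A → A → Prop := fun a b => r (I.D.tail a) ≤ r (I.D.tail b)
  have : Std.Total le := ⟨fun a b => le_total _ _⟩
  have : IsTrans A le := ⟨fun a b c => le_trans⟩
  let L := A'.toList.insertionSort le
  have hperm : L.Perm A'.toList := List.perm_insertionSort le _
  have hsort : L.Pairwise le := List.pairwise_insertionSort le _
  have hmem : ∀ a, a ∈ L ↔ a ∈ A' := fun a => by simp [hperm.mem_iff]
  have hnd : L.Nodup := hperm.nodup_iff.2 A'.nodup_toList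
  have hwalk : ∀ i, I.D.IsWalk I.s (L.filter (· ∈ I.color i)) I.t := by
    intro i
    obtain ⟨l, hl, hla⟩ := hA i
    have hlt := (hl.1.pairwise_rank hr).2
    have hlnd : l.Nodup := (List.nodup_cons.1 hl.2).2.of_map
    have hp : (L.filter (· ∈ I.color i)).Perm l := by
      rw [List.perm_ext_iff_of_nodup (hnd.filter _) hlnd]
      intro a
      simp [hla, hmem]
    have heq : L.filter (· ∈ I.color i) = l := by
      refine hp.eq_of_pairwise (le := le) ?_ (hsort.filter _) (hlt.imp fun h => h.le)
      intro a b ha hb hab hba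
      have hinj : (l.map fun a => r (I.D.tail a)).Nodup :=
        List.pairwise_map.2 (hlt.imp fun h => h.ne)
      exact List.inj_on_of_nodup_map hinj (hp.mem_iff.1 ha) hb (le_antisymm hab hba)
    rw [heq]
    exact hl.1
  obtain ⟨P, hP, hPL⟩ := exists_isWalk_of_proj (u := fun _ => I.s) (v := fun _ => I.t) hwalk
  refine ⟨P, hP, fun a => ?_, ?_⟩
  · rw [← hmem, ← hPL, List.mem_map]
  · rw [cost, ← Finset.sum_map_toList, ← (hperm.map _).sum_eq, ← hPL, auxCost, List.map_map]
    rfl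

end ExactSimDipaths

/-! ### Reasoning about programs of the random access machine -/

namespace RAM

@[simp] theorem State.writeN_num (σ : State) (b j v b' j' : ℕ) :
    (σ.writeN b j v).num b' j' = if b' = b ∧ j' = j then v else σ.num b' j' := by
  by_cases hb : b' = b
  · subst hb
    by_cases hj : j' = j <;> simp [State.writeN, hj]
  · simp [State.writeN, hb]

@[simp] theorem State.writeN_real (σ : State) (b j v : ℕ) :
    (σ.writeN b j v).real = σ.real := rfl

@[simp] theorem State.writeR_real (σ : State) (b j : ℕ) (v : ℝ) (b' j' : ℕ) :
    (σ.writeR b j v).real b' j' = if b' = b ∧ j' = j then v else σ.real b' j' := by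
  by_cases hb : b' = b
  · subst hb
    by_cases hj : j' = j <;> simp [State.writeR, hj]
  · simp [State.writeR, hb]

@[simp] theorem State.writeR_num (σ : State) (b j : ℕ) (v : ℝ) :
    (σ.writeR b j v).num = σ.num := rfl

attribute [simp] NExp.eval RExp.eval Test.holds

/-- The sum of the expressions `f 0, …, f (k - 1)`. -/
def NExp.sum (f : ℕ → NExp) : ℕ → NExp
  | 0 => .lit 0
  | k + 1 => .add (NExp.sum f k) (f k)

@[simp] theorem NExp.eval_sum (σ : State) (f : ℕ → NExp) (k : ℕ) :
    (NExp.sum f k).eval σ = ∑ i ∈ Finset.range k, (f i).eval σ := by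
  induction k with
  | zero => rfl
  | succ k ih => rw [Finset.sum_range_succ, ← ih]; rfl

/-- The conjunction of the tests `f 0, …, f (k - 1)`. -/
def Test.all (f : ℕ → Test) : ℕ → Test
  | 0 => .not (.nlt (.lit 0) (.lit 0))
  | k + 1 => .and (Test.all f k) (f k)

@[simp] theorem Test.holds_all (σ : State) (f : ℕ → Test) (k : ℕ) :
    (Test.all f k).holds σ ↔ ∀ i < k, (f i).holds σ := by
  induction k with
  | zero => simp [Test.all]
  | succ k ih => simp only [Test.all, Test.holds, ih, Nat.forall_lt_succ_right]

/-- The programs `f 0, …, f (k - 1)` one after the other. -/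
def Program.unroll (f : ℕ → Program) : ℕ → Program
  | 0 => .skip
  | k + 1 => .seq (Program.unroll f k) (f k)

/-- The program that runs `p` for each value `0, 1, …` below that of `N` of the counter in
register `c` of bank 6. -/
def Program.forLoop (c : ℕ) (N : NExp) (p : Program) : Program :=
  .seq (.setN 6 (.lit c) (.lit 0))
    (.loop (.nlt (.get 6 (.lit c)) N)
      (.seq p (.setN 6 (.lit c) (.add (.get 6 (.lit c)) (.lit 1)))))

/-- Total correctness with a time bound: started in a state with the property `P`, the program
halts after at most `B` steps in a state with the property `Q`. -/
def Triple (P : State → Prop) (p : Program) (B : ℕ) (Q : State → Prop) : Prop :=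
  ∀ σ, P σ → ∃ T τ, Runs p σ T τ ∧ T ≤ B ∧ Q τ

theorem Triple.seq {P Q R : State → Prop} {p q : Program} {B C : ℕ} (hp : Triple P p B Q)
    (hq : Triple Q q C R) : Triple P (.seq p q) (B + C) R := by
  intro σ hσ
  obtain ⟨T₁, τ₁, h₁, hT₁, hQ⟩ := hp σ hσ
  obtain ⟨T₂, τ₂, h₂, hT₂, hR⟩ := hq τ₁ hQ
  exact ⟨_, _, .seq h₁ h₂, by omega, hR⟩

theorem Triple.weaken {P P' Q Q' : State → Prop} {p : Program} {B : ℕ} (hp : Triple P p B Q)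
    (hP : ∀ σ, P' σ → P σ) (hQ : ∀ σ, Q σ → Q' σ) : Triple P' p B Q' := by
  intro σ hσ
  obtain ⟨T, τ, h, hT, hτ⟩ := hp σ (hP σ hσ)
  exact ⟨T, τ, h, hT, hQ τ hτ⟩

theorem Triple.ite {P Q : State → Prop} {b : Test} {p q : Program} {B C : ℕ}
    (hp : Triple (fun σ => P σ ∧ b.holds σ) p B Q)
    (hq : Triple (fun σ => P σ ∧ ¬ b.holds σ) q C Q) :
    Triple P (.ite b p q) (b.steps + B + C) Q := by
  intro σ hσ
  by_cases hb : b.holds σ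
  · obtain ⟨T, τ, h, hT, hτ⟩ := hp σ ⟨hσ, hb⟩
    exact ⟨_, _, .iteTrue hb h, by omega, hτ⟩
  · obtain ⟨T, τ, h, hT, hτ⟩ := hq σ ⟨hσ, hb⟩
    exact ⟨_, _, .iteFalse hb h, by omega, hτ⟩

theorem Triple.unroll {f : ℕ → Program} {P : ℕ → State → Prop} {B k : ℕ}
    (h : ∀ i < k, Triple (P i) (f i) B (P (i + 1))) :
    Triple (P 0) (Program.unroll f k) (k * B + 1) (P k) := by
  induction k with
  | zero => exact fun σ hσ => ⟨1, σ, .skip σ, by simp, hσ⟩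
  | succ k ih =>
    have := (ih fun i hi => h i (by omega)).seq (h k (by omega))
    rwa [show k * B + 1 + B = (k + 1) * B + 1 by ring] at this

/-- A bound for the number of steps of a counting loop with `M` rounds of at most `B` steps each,
where the evaluation of the upper end takes `s` steps. -/
def loopCost (s M B : ℕ) : ℕ := 3 + (M + 1) * (s + 9 + B)

/-- The invariant `P x` of a counting loop has to hold whenever the counter is set to `x`. -/
theorem Triple.forLoop {P : ℕ → State → Prop} {P₀ : State → Prop} {c : ℕ} {N : NExp}
    {p : Program} {M B : ℕ} (h₀ : ∀ σ, P₀ σ → P 0 (σ.writeN 6 c 0))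
    (hP : ∀ x σ, P x σ → σ.num 6 c = x ∧ N.eval σ = M)
    (hp : ∀ x < M, Triple (P x) p B fun τ => P (x + 1) (τ.writeN 6 c (τ.num 6 c + 1))) :
    Triple P₀ (.forLoop c N p) (loopCost N.steps M B) (P M) := by
  have key : ∀ d x σ, x + d = M → P x σ → ∃ T τ,
      Runs (.loop (.nlt (.get 6 (.lit c)) N)
        (.seq p (.setN 6 (.lit c) (.add (.get 6 (.lit c)) (.lit 1))))) σ T τ ∧
      T ≤ (d + 1) * (N.steps + 9 + B) ∧ P M τ := by
    intro d
    induction d with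
    | zero =>
      intro x σ hx hσ
      obtain ⟨h1, h2⟩ := hP x σ hσ
      obtain rfl : x = M := by omega
      refine ⟨_, σ, .loopFalse (by simp [h1, h2]), ?_, hσ⟩
      simp only [Test.steps, NExp.steps]
      omega
    | succ d ih =>
      intro x σ hx hσ
      obtain ⟨h1, h2⟩ := hP x σ hσ
      obtain ⟨T₁, τ₁, hr₁, hT₁, hτ₁⟩ := hp x (by omega) σ hσ
      obtain ⟨T₂, τ₂, hr₂, hT₂, hτ₂⟩ := ih (x + 1) _ (by omega) hτ₁
      refine ⟨_, τ₂, .loopTrue (by simp [h1, h2]; omega) (.seq hr₁ (.setN _ _ _ _)) hr₂, ?_, hτ₂⟩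
      simp only [Test.steps, NExp.steps]
      rw [show (d + 1 + 1) * (N.steps + 9 + B) = (d + 1) * (N.steps + 9 + B) + (N.steps + 9 + B) by
        ring]
      omega
  intro σ hσ
  obtain ⟨T, τ, hr, hT, hτ⟩ := key M 0 _ (by omega) (h₀ σ hσ)
  refine ⟨_, τ, .seq (.setN _ _ _ _) hr, ?_, hτ⟩
  simp only [NExp.steps, loopCost]
  omega

/-- The state after the execution of a program without loops. -/
noncomputable def Program.exec : Program → State → State
  | .skip, σ => σ
  | .setN b i v, σ => σ.writeN b (i.eval σ) (v.eval σ)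
  | .setR b i v, σ => σ.writeR b (i.eval σ) (v.eval σ)
  | .seq p q, σ => q.exec (p.exec σ)
  | .ite b p q, σ => open Classical in if b.holds σ then p.exec σ else q.exec σ
  | .loop _ _, σ => σ

/-- The program contains no loops. -/
def Program.LoopFree : Program → Prop
  | .skip => True
  | .setN _ _ _ => True
  | .setR _ _ _ => True
  | .seq p q => p.LoopFree ∧ q.LoopFree
  | .ite _ p q => p.LoopFree ∧ q.LoopFree
  | .loop _ _ => False

/-- A bound for the number of steps of a program without loops. -/
def Program.cost : Program → ℕ
  | .skip => 1
  | .setN _ i v => i.steps + v.steps + 1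
  | .setR _ i v => i.steps + v.steps + 1
  | .seq p q => p.cost + q.cost
  | .ite b p q => b.steps + p.cost + q.cost
  | .loop _ _ => 0

theorem Program.LoopFree.unroll {f : ℕ → Program} (h : ∀ i, (f i).LoopFree) (k : ℕ) :
    (Program.unroll f k).LoopFree := by
  induction k with
  | zero => trivial
  | succ k ih => exact ⟨ih, h k⟩

theorem Program.LoopFree.runs {p : Program} (hp : p.LoopFree) (σ : State) :
    ∃ T, Runs p σ T (p.exec σ) ∧ T ≤ p.cost := by
  induction p generalizing σ with
  | skip => exact ⟨_, .skip σ, le_rfl⟩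
  | setN b i v => exact ⟨_, .setN σ b i v, le_rfl⟩
  | setR b i v => exact ⟨_, .setR σ b i v, le_rfl⟩
  | seq p q ihp ihq =>
    obtain ⟨T₁, h₁, hT₁⟩ := ihp hp.1 σ
    obtain ⟨T₂, h₂, hT₂⟩ := ihq hp.2 (p.exec σ)
    exact ⟨_, .seq h₁ h₂, add_le_add hT₁ hT₂⟩
  | ite b p q ihp ihq =>
    by_cases hb : b.holds σ
    · obtain ⟨T, h, hT⟩ := ihp hp.1 σ
      refine ⟨_, .iteTrue hb (by simpa [Program.exec, hb] using h), ?_⟩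
      simp only [Program.cost]
      omega
    · obtain ⟨T, h, hT⟩ := ihq hp.2 σ
      refine ⟨_, .iteFalse hb (by simpa [Program.exec, hb] using h), ?_⟩
      simp only [Program.cost]
      omega
  | loop => exact hp.elim

theorem Triple.of_loopFree {p : Program} (hp : p.LoopFree) {P Q : State → Prop}
    (h : ∀ σ, P σ → Q (p.exec σ)) : Triple P p p.cost Q := by
  intro σ hσ
  obtain ⟨T, hr, hT⟩ := hp.runs σ
  exact ⟨T, _, hr, hT, h σ hσ⟩

/-- The function `f` of two arguments is at most a polynomial in their sum. -/
def PolyBound (f : ℕ → ℕ → ℕ) : Prop := ∃ p : Polynomial ℕ, ∀ n m, f n m ≤ p.eval (n + m)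

namespace PolyBound

theorem const (a : ℕ) : PolyBound fun _ _ => a := ⟨.C a, by simp⟩

theorem left : PolyBound fun n _ => n := ⟨.X, by simp⟩

theorem right : PolyBound fun _ m => m := ⟨.X, by simp⟩

theorem add {f g : ℕ → ℕ → ℕ} (hf : PolyBound f) (hg : PolyBound g) :
    PolyBound fun n m => f n m + g n m := by
  obtain ⟨p, hp⟩ := hf
  obtain ⟨q, hq⟩ := hg
  exact ⟨p + q, fun n m => by simpa using add_le_add (hp n m) (hq n m)⟩

theorem mul {f g : ℕ → ℕ → ℕ} (hf : PolyBound f) (hg : PolyBound g) :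
    PolyBound fun n m => f n m * g n m := by
  obtain ⟨p, hp⟩ := hf
  obtain ⟨q, hq⟩ := hg
  exact ⟨p * q, fun n m => by simpa using Nat.mul_le_mul (hp n m) (hq n m)⟩

theorem pow {f : ℕ → ℕ → ℕ} (hf : PolyBound f) (k : ℕ) : PolyBound fun n m => f n m ^ k := by
  obtain ⟨p, hp⟩ := hf
  exact ⟨p ^ k, fun n m => by simpa using Nat.pow_le_pow_left (hp n m) k⟩

theorem loopCost {f g : ℕ → ℕ → ℕ} (s : ℕ) (hf : PolyBound f) (hg : PolyBound g) :
    PolyBound fun n m => loopCost s (f n m) (g n m) :=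
  (const 3).add ((hf.add (const 1)).mul ((const (s + 9)).add hg))

end PolyBound

end RAM

/-! ### The program -/

namespace RAM

open Program

/-- The expression for the content of register `r` of the number bank 6, which holds the scalar
variables: 0 the number of states, 1 the round, 2 the state and 3 the arc under consideration, 4 the
state to be updated (later the bit mask to be decoded), 5 the counter of the remaining loops. -/
def var (r : ℕ) : NExp := .get 6 (.lit r)

/-- The expression for the number of the tuple with entries `f 0, …, f (k - 1)`, by means of the
tables of multiples in the banks `11 + 2 * i`. -/
def indexExp (k : ℕ) (f : ℕ → NExp) : NExp := .sum (fun i => .get (11 + 2 * i) (f i)) k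

/-- Fills, for each `i < k`, the bank `11 + 2 * i` with the multiples `x * n ^ i`, `x ≤ n`, and
leaves `n ^ k` in the variable 0. -/
def makeMultiples (k : ℕ) : Program :=
  .seq (.setN 6 (.lit 0) (.lit 1))
    (.unroll (fun i =>
      .seq (.setN (11 + 2 * i) (.lit 0) (.lit 0))
        (.seq
          (.forLoop 5 (.get 0 (.lit 0))
            (.setN (11 + 2 * i) (.add (var 5) (.lit 1))
              (.add (.get (11 + 2 * i) (var 5)) (var 0))))
          (.setN 6 (.lit 0) (.get (11 + 2 * i) (.get 0 (.lit 0)))))) k)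

/-- Fills bank 9 with the powers of two up to `2 ^ m`. -/
def makePowers : Program :=
  .seq (.setN 9 (.lit 0) (.lit 1))
    (.forLoop 5 (.get 0 (.lit 1))
      (.setN 9 (.add (var 5) (.lit 1)) (.add (.get 9 (var 5)) (.get 9 (var 5)))))

/-- Stores the values `f i` as the entries of the tuple with the number in the variable 4. -/
def setCoords (k : ℕ) (f : ℕ → NExp) : Program :=
  .unroll (fun i => .setN (12 + 2 * i) (var 4) (f i)) k

/-- Makes `(s, …, s)` the only reached state, by the empty walk. -/
def initTable (k : ℕ) : Program :=
  .seq (.setN 6 (.lit 4) (indexExp k fun _ => .get 0 (.lit 2)))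
    (.seq (.setN 7 (var 4) (.lit 1))
      (.seq (.setN 8 (var 4) (.lit 0))
        (.seq (.setR 1 (var 4) .zero) (setCoords k fun _ => .get 0 (.lit 2)))))

/-- Does the arc in the variable 3 have the color `i`? -/
def hasColor (k i : ℕ) : Test := .nlt (.lit 0) (.get 3 (.add (.sum (fun _ => var 3) k) (.lit i)))

/-- Is the state in the variable 2 reached, and does it have the tail of the arc in the variable 3
in all coordinates that belong to colors of this arc? -/
def canMove (k : ℕ) : Test :=
  .and (.nlt (.lit 0) (.get 7 (var 2)))
    (.all (fun i =>
      .not (.and (hasColor k i)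
        (.not (.and (.not (.nlt (.get (12 + 2 * i) (var 2)) (.get 1 (var 3))))
          (.not (.nlt (.get 1 (var 3)) (.get (12 + 2 * i) (var 2)))))))) k)

/-- Computes in bank 10 the entry `i` of the state to which the arc in the variable 3 leads from the
state in the variable 2. -/
def moveCoord (k i : ℕ) : Program :=
  .ite (hasColor k i) (.setN 10 (.lit i) (.get 2 (var 3)))
    (.setN 10 (.lit i) (.get (12 + 2 * i) (var 2)))

/-- The cost of reaching the state in the variable 4 by the arc under consideration. -/
def newDist : RExp := .add (.get 1 (var 2)) (.get 0 (var 3))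

/-- Is the state in the variable 4 reached at a cost that is not greater than the new one? -/
def noGain : Test := .and (.nlt (.lit 0) (.get 7 (var 4))) (.not (.rlt newDist (.get 1 (var 4))))

/-- Replaces the data of the state in the variable 4. -/
def update (k : ℕ) : Program :=
  .seq (.setN 7 (var 4) (.lit 1))
    (.seq (.setR 1 (var 4) newDist)
      (.seq (.setN 8 (var 4) (.add (.get 8 (var 2)) (.get 9 (var 3))))
        (setCoords k fun i => .get 10 (.lit i))))

/-- One step of the method of Bellman and Ford: the walk that is known for the state in the
variable 2 is extended by the arc in the variable 3, if that is possible and worthwhile. -/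
def relax (k : ℕ) : Program :=
  .ite (canMove k)
    (.seq (.unroll (moveCoord k) k)
      (.seq (.setN 6 (.lit 4) (indexExp k fun i => .get 10 (.lit i))) (.ite noGain .skip (update k))))
    .skip

/-- `m` rounds of relaxations of all arcs in all states. -/
def search (k : ℕ) : Program :=
  .forLoop 1 (.get 0 (.lit 1)) (.forLoop 2 (var 0) (.forLoop 3 (.get 0 (.lit 1)) (relax k)))

/-- The arc that is considered in the round `var 5` of the decoding, counted from the last arc. -/
def decodeArc : NExp := .sub (.get 0 (.lit 1)) (.add (var 5) (.lit 1))

/-- Reads off the binary digits of the variable 4, beginning with the highest one. -/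
def decode : Program :=
  .forLoop 5 (.get 0 (.lit 1))
    (.ite (.nlt (var 4) (.get 9 decodeArc)) (.setN 5 decodeArc (.lit 0))
      (.seq (.setN 6 (.lit 4) (.sub (var 4) (.get 9 decodeArc))) (.setN 5 decodeArc (.lit 1))))

/-- Reports the result for the state `(t, …, t)`. -/
def answer (k : ℕ) : Program :=
  .seq (.setN 6 (.lit 4) (indexExp k fun _ => .get 0 (.lit 3)))
    (.ite (.nlt (.lit 0) (.get 7 (var 4)))
      (.seq (.setN 4 (.lit 0) (.lit 1)) (.seq (.setN 6 (.lit 4) (.get 8 (var 4))) decode))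
      (.setN 4 (.lit 0) (.lit 0)))

/-- The algorithm: a search for walks of minimum cost from `(s, …, s)` in the auxiliary digraph.

Besides the input in the banks 0 to 3, the scalar variables in bank 6 and the result in the banks 4
and 5, the memory holds the following data. For a state with the number `j`, register `j` of number
bank 7 tells whether the state has been reached; if so, register `j` of bank 8 is the bit mask of
the arcs of the best known walk, register `j` of bank `12 + 2 * i` is the entry `i` of the tuple,
and register `j` of real bank 1 is the cost of the walk. Register `a` of number bank 9 holds
`2 ^ a`, register `x` of bank `11 + 2 * i` holds `x * n ^ i`, and bank 10 holds a tuple of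
vertices. -/
def solve (k : ℕ) : Program :=
  .seq (makeMultiples k)
    (.seq makePowers (.seq (initTable k) (.seq (search k) (answer k))))

/-! ### The effect of the parts without loops -/

attribute [simp] var

theorem loopFree_setCoords (k : ℕ) (f : ℕ → NExp) : (setCoords k f).LoopFree :=
  LoopFree.unroll (f := fun i => .setN (12 + 2 * i) (var 4) (f i)) (fun _ => trivial) k

theorem loopFree_initTable (k : ℕ) : (initTable k).LoopFree :=
  ⟨trivial, trivial, trivial, trivial, loopFree_setCoords k _⟩

theorem loopFree_relax (k : ℕ) : (relax k).LoopFree :=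
  ⟨⟨LoopFree.unroll (f := moveCoord k) (fun _ => ⟨trivial, trivial⟩) k, trivial, trivial, trivial, trivial, trivial,
    loopFree_setCoords k _⟩, trivial⟩

/-- The values that `setCoords` stores may not depend on the banks that it writes to. -/
theorem exec_setCoords (k : ℕ) (f : ℕ → NExp) (σ : State)
    (hf : ∀ i τ, (∀ b < 11, τ.num b = σ.num b) → (f i).eval τ = (f i).eval σ) :
    ((setCoords k f).exec σ).real = σ.real ∧
    (∀ b x, (∀ i < k, b ≠ 12 + 2 * i) ∨ x ≠ σ.num 6 4 →
      ((setCoords k f).exec σ).num b x = σ.num b x) ∧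
    ∀ i < k, ((setCoords k f).exec σ).num (12 + 2 * i) (σ.num 6 4) = (f i).eval σ := by
  induction k with
  | zero => exact ⟨rfl, fun _ _ _ => rfl, by simp⟩
  | succ k ih =>
    obtain ⟨h1, h2, h3⟩ := ih
    have hlow : ∀ b < 11, ((setCoords k f).exec σ).num b = σ.num b := fun b hb =>
      funext fun x => h2 b x (.inl fun i _ => by omega)
    have hs : (setCoords (k + 1) f).exec σ = ((setCoords k f).exec σ).writeN (12 + 2 * k)
        (σ.num 6 4) ((f k).eval σ) := by
      have : (setCoords (k + 1) f).exec σ = ((setCoords k f).exec σ).writeN (12 + 2 * k)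
        (((setCoords k f).exec σ).num 6 4) ((f k).eval ((setCoords k f).exec σ)) := rfl
      rw [this, hf k _ hlow, hlow 6 (by omega)]
    rw [hs]
    refine ⟨h1, fun b x hbx => ?_, fun i hi => ?_⟩
    · rw [State.writeN_num, if_neg, h2]
      · exact hbx.imp_left fun h i hi => h i (by omega)
      · rintro ⟨rfl, rfl⟩
        exact hbx.elim (fun h => h k (by omega) rfl) fun h => h rfl
    · rw [State.writeN_num]
      split_ifs with h
      · obtain rfl : i = k := by omega
        rfl
      · exact h3 i (by omega)

open Classical in
/-- The number of colors `K` is kept apart from the number `k` of the entries computed so far, for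
the sake of the induction. -/
theorem exec_moveCoords (k K : ℕ) (σ : State) :
    let p := Program.unroll (moveCoord K) k
    (p.exec σ).real = σ.real ∧ (∀ b ≠ 10, (p.exec σ).num b = σ.num b) ∧
    ∀ i < k, (p.exec σ).num 10 i =
      if (hasColor K i).holds σ then σ.num 2 (σ.num 6 3) else σ.num (12 + 2 * i) (σ.num 6 2) := by
  induction k with
  | zero => exact ⟨rfl, fun _ _ => rfl, by simp⟩
  | succ k ih =>
    obtain ⟨h1, h2, h3⟩ := ih
    simp only [Program.unroll, moveCoord, Program.exec]
    generalize Program.exec _ σ = τ at h1 h2 h3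
    have hc : ∀ i, (hasColor K i).holds τ ↔ (hasColor K i).holds σ := by
      intro i
      simp [hasColor, h2]
    refine ⟨?_, fun b hb => ?_, fun i hi => ?_⟩
    · split_ifs <;> simp [h1]
    · funext x
      split_ifs <;> simp [hb, h2]
    · rcases Nat.lt_succ_iff_lt_or_eq.1 hi with hi | rfl
      · rw [← h3 i hi]
        split_ifs <;> simp [hi.ne]
      · simp only [hc]
        split_ifs <;> simp [h2, show 12 + 2 * i ≠ 10 by omega]

end RAM

/-! ### Invariants of the search -/

namespace ExactSimDipaths

open RAM

variable {k n m : ℕ} {I : ExactSimDipaths k (Fin n) (Fin m)}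

/-- The number of a tuple of vertices: its entries are the digits to the base `n`. -/
def stateIndex (u : Fin k → Fin n) : ℕ := ∑ i, (u i : ℕ) * n ^ (i : ℕ)

theorem stateIndex_eq (u : Fin k → Fin n) : stateIndex u = finFunctionFinEquiv u :=
  (finFunctionFinEquiv_apply u).symm

theorem stateIndex_injective : Function.Injective (stateIndex : (Fin k → Fin n) → ℕ) := by
  intro u v h
  rw [stateIndex_eq, stateIndex_eq] at h
  exact finFunctionFinEquiv.injective (Fin.ext h)

theorem stateIndex_lt (u : Fin k → Fin n) : stateIndex u < n ^ k := by
  rw [stateIndex_eq]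
  exact (finFunctionFinEquiv u).2

theorem input_tail (a : Fin m) : I.input.num 1 a = I.D.tail a := by simp [input]

theorem input_head (a : Fin m) : I.input.num 2 a = I.D.head a := by simp [input]

theorem input_cost (a : Fin m) : I.input.real 0 a = I.c a := by simp [input]

theorem input_color (a : Fin m) (i : Fin k) : 0 < I.input.num 3 (a * k + i) ↔ a ∈ I.color i := by
  have h : I.input.num 3 (a * k + i) = if ∃ (b : Fin m) (j : Fin k),
      (a : ℕ) * k + i = b * k + j ∧ b ∈ I.color j then 1 else 0 := rfl
  rw [h]
  refine ⟨fun h => ?_, fun h => by rw [if_pos ⟨a, i, rfl, h⟩]; exact one_pos⟩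
  split_ifs at h with h'
  · obtain ⟨b, j, hbj, hb⟩ := h'
    have hk := i.pos
    have h1 := congrArg (· / k) hbj
    have h2 := congrArg (· % k) hbj
    simp only [Nat.mul_add_mod', Nat.mod_eq_of_lt i.2, Nat.mod_eq_of_lt j.2] at h2
    simp only [mul_comm _ k, Nat.mul_add_div hk, Nat.div_eq_of_lt i.2, Nat.div_eq_of_lt j.2,
      add_zero] at h1
    rwa [Fin.ext h1, Fin.ext h2]
  · exact absurd h (lt_irrefl 0)

/-- The input is still in place, and the tables are filled. -/
structure Prepared (I : ExactSimDipaths k (Fin n) (Fin m)) (σ : State) : Prop where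
  input : ∀ b < 4, σ.num b = I.input.num b
  cost : σ.real 0 = I.input.real 0
  size : σ.num 6 0 = n ^ k
  multiples : ∀ i < k, ∀ x < n, σ.num (11 + 2 * i) x = x * n ^ i
  powers : ∀ a < m, σ.num 9 a = 2 ^ a

theorem Prepared.congr {σ τ : State} (h : Prepared I σ) (h₀ : ∀ b < 4, τ.num b = σ.num b)
    (h₁ : τ.real 0 = σ.real 0) (h₂ : τ.num 6 0 = σ.num 6 0) (h₃ : τ.num 9 = σ.num 9)
    (h₄ : ∀ i < k, τ.num (11 + 2 * i) = σ.num (11 + 2 * i)) : Prepared I τ where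
  input b hb := by rw [h₀ b hb, h.input b hb]
  cost := by rw [h₁, h.cost]
  size := by rw [h₂, h.size]
  multiples i hi x hx := by rw [h₄ i hi, h.multiples i hi x hx]
  powers a ha := by rw [h₃, h.powers a ha]

theorem Prepared.n_eq {σ : State} (h : Prepared I σ) : σ.num 0 0 = n := h.input 0 (by omega) ▸ rfl

theorem Prepared.m_eq {σ : State} (h : Prepared I σ) : σ.num 0 1 = m := h.input 0 (by omega) ▸ rfl

theorem Prepared.s_eq {σ : State} (h : Prepared I σ) : σ.num 0 2 = I.s := h.input 0 (by omega) ▸ rfl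

theorem Prepared.t_eq {σ : State} (h : Prepared I σ) : σ.num 0 3 = I.t := h.input 0 (by omega) ▸ rfl

theorem Prepared.eval_indexExp {σ : State} (h : Prepared I σ) {f : ℕ → NExp} {u : Fin k → Fin n}
    (hf : ∀ i : Fin k, (f i).eval σ = u i) : (indexExp k f).eval σ = stateIndex u := by
  rw [indexExp, NExp.eval_sum, stateIndex, Finset.sum_range]
  refine Finset.sum_congr rfl fun i _ => ?_
  rw [NExp.eval, hf, h.multiples i i.2 _ (u i).2]

theorem Prepared.hasColor_iff {σ : State} (h : Prepared I σ) {a : Fin m} (ha : σ.num 6 3 = a)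
    (i : Fin k) : (hasColor k i).holds σ ↔ a ∈ I.color i := by
  rw [← input_color, ← h.input 3 (by omega)]
  simp [hasColor, ha, mul_comm]

/-- The row `j` of the table describes the walk `Q` from `(s, …, s)` to the tuple `u` with the
number `j`: its end, its cost, and the set of the arcs it was built from, as a bit mask. -/
structure Describes (I : ExactSimDipaths k (Fin n) (Fin m)) (σ : State) (j : ℕ)
    (u : Fin k → Fin n) (Q : List I.AuxArc) : Prop where
  index : stateIndex u = j
  walk : I.aux.IsWalk (fun _ => I.s) Q u
  coord : ∀ i : Fin k, σ.num (12 + 2 * i) j = u i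
  dist : σ.real 1 j = I.auxCost Q
  mask : σ.num 8 j = (Q.map fun e => 2 ^ (e.arc : ℕ)).sum

/-- Every reached state is described by its row. -/
def Sound (I : ExactSimDipaths k (Fin n) (Fin m)) (σ : State) : Prop :=
  ∀ j, 0 < σ.num 7 j → ∃ u Q, Describes I σ j u Q

/-- The tuple `u` is reached at a cost of at most `γ`. -/
def ReachedAt (σ : State) (u : Fin k → Fin n) (γ : ℝ) : Prop :=
  0 < σ.num 7 (stateIndex u) ∧ σ.real 1 (stateIndex u) ≤ γ

/-- The rows `j` of the tables in `σ` and `τ` agree. -/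
structure SameRow (k : ℕ) (σ τ : State) (j : ℕ) : Prop where
  reached : τ.num 7 j = σ.num 7 j
  dist : τ.real 1 j = σ.real 1 j
  mask : τ.num 8 j = σ.num 8 j
  coord : ∀ i < k, τ.num (12 + 2 * i) j = σ.num (12 + 2 * i) j

theorem Describes.congr {σ τ : State} {j : ℕ} {u : Fin k → Fin n} {Q : List I.AuxArc}
    (h : Describes I σ j u Q) (hj : SameRow k σ τ j) : Describes I τ j u Q :=
  ⟨h.index, h.walk, fun i => by rw [hj.coord i i.2, h.coord], by rw [hj.dist, h.dist],
    by rw [hj.mask, h.mask]⟩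

/-- An arc of the auxiliary digraph is determined by its tail and the arc it was added for. -/
theorem AuxArc.dst_eq {e e' : I.AuxArc} (ha : e.arc = e'.arc) (hs : e.src = e'.src) :
    e.dst = e'.dst := by
  funext i
  by_cases hi : e.arc ∈ I.color i
  · rw [(e.moved i hi).2, (e'.moved i (ha ▸ hi)).2, ha]
  · rw [← e.fixed i hi, ← e'.fixed i (ha ▸ hi), hs]

/-- The effect of a relaxation with the arc `a` in the state `j`: either the table remains the same
and no arc of the auxiliary digraph that was added for `a` and leaves `j` would improve it, or there
is such an arc and the row of its head is replaced by data that are not worse. -/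
theorem exec_relax {σ : State} (hσ : Prepared I σ) (hS : Sound I σ) {a : Fin m}
    (ha : σ.num 6 3 = a) :
    (∀ b, b ≠ 7 → b ≠ 8 → b ≠ 10 → (∀ i < k, b ≠ 12 + 2 * i) → ∀ x, b ≠ 6 ∨ x ≠ 4 →
      ((relax k).exec σ).num b x = σ.num b x) ∧
    ((relax k).exec σ).real 0 = σ.real 0 ∧
    ((∀ j, SameRow k σ ((relax k).exec σ) j) ∧
        (∀ e : I.AuxArc, e.arc = a → stateIndex e.src = σ.num 6 2 → 0 < σ.num 7 (σ.num 6 2) →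
          ReachedAt σ e.dst (σ.real 1 (σ.num 6 2) + I.c a)) ∨
      ∃ e : I.AuxArc, e.arc = a ∧ stateIndex e.src = σ.num 6 2 ∧ 0 < σ.num 7 (σ.num 6 2) ∧
        (∀ j, j ≠ stateIndex e.dst → SameRow k σ ((relax k).exec σ) j) ∧
        ((relax k).exec σ).num 7 (stateIndex e.dst) = 1 ∧
        ((relax k).exec σ).real 1 (stateIndex e.dst) = σ.real 1 (σ.num 6 2) + I.c a ∧
        ((relax k).exec σ).num 8 (stateIndex e.dst) = σ.num 8 (σ.num 6 2) + 2 ^ (a : ℕ) ∧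
        (∀ i : Fin k, ((relax k).exec σ).num (12 + 2 * i) (stateIndex e.dst) = e.dst i) ∧
        ¬ ReachedAt σ e.dst (σ.real 1 (σ.num 6 2) + I.c a)) := by
  classical
  set j := σ.num 6 2 with hj
  have htail : σ.num 1 a = I.D.tail a := by rw [hσ.input 1 (by omega), input_tail]
  have hhead : σ.num 2 a = I.D.head a := by rw [hσ.input 2 (by omega), input_head]
  have hcost : σ.real 0 a = I.c a := by rw [hσ.cost, input_cost]
  have hsame : ∀ j, SameRow k σ σ j := fun j => ⟨rfl, rfl, rfl, fun _ _ => rfl⟩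
  have hcan : (canMove k).holds σ ↔
      0 < σ.num 7 j ∧ ∀ i : Fin k, a ∈ I.color i → σ.num (12 + 2 * i) j = I.D.tail a := by
    simp only [canMove, Test.holds, Test.holds_all, NExp.eval, var, ← hj, ha, htail]
    refine and_congr_right fun _ => ⟨fun h i hi => ?_, fun h i hi => ?_⟩
    · have := h i i.2
      rw [hσ.hasColor_iff ha] at this
      by_contra hne
      exact this ⟨hi, by omega⟩
    · have := h ⟨i, hi⟩
      rw [← hσ.hasColor_iff ha] at this
      rintro ⟨h1, h2⟩
      have := this h1
      simp only at this
      omega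
  by_cases hmove : (canMove k).holds σ
  swap
  -- the state `j` is not reached, or the arc `a` does not leave it
  · have hτ : (relax k).exec σ = σ := by simp [relax, Program.exec, hmove]
    rw [hτ]
    refine ⟨fun _ _ _ _ _ _ _ => rfl, rfl, .inl ⟨hsame, fun e he hes hr => ?_⟩⟩
    obtain ⟨u, Q, hQ⟩ := hS j hr
    obtain rfl : e.src = u := stateIndex_injective (hes.trans hQ.index.symm)
    refine absurd (hcan.2 ⟨hr, fun i hi => ?_⟩) hmove
    rw [hQ.coord, (e.moved i (he ▸ hi)).1, he]
  obtain ⟨hr, hmv⟩ := hcan.1 hmove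
  obtain ⟨u, Q, hQ⟩ := hS j hr
  -- the arc of the auxiliary digraph along which the relaxation goes
  let e : I.AuxArc :=
    { arc := a
      src := u
      dst := fun i => if a ∈ I.color i then I.D.head a else u i
      moved := fun i hi => ⟨Fin.ext (by rw [← hmv i hi, hQ.coord]), if_pos hi⟩
      fixed := fun i hi => (if_neg hi).symm }
  have huniq : ∀ e' : I.AuxArc, e'.arc = a → stateIndex e'.src = j → e'.dst = e.dst :=
    fun e' he' hs' => AuxArc.dst_eq he' (stateIndex_injective (hs'.trans hQ.index.symm))
  obtain ⟨f1, f2, f3⟩ := exec_moveCoords k k σ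
  set σ₁ := (Program.unroll (moveCoord k) k).exec σ with hσ₁
  have hnew : ∀ i : Fin k, σ₁.num 10 i = e.dst i := by
    intro i
    rw [f3 i i.2, hσ.hasColor_iff ha, ha, hhead, ← hj, hQ.coord]
    show _ = ((if a ∈ I.color i then I.D.head a else u i : Fin n) : ℕ)
    split_ifs <;> rfl
  have hprep : Prepared I σ₁ := hσ.congr (fun b hb => f2 b (by omega)) (by rw [f1])
    (by rw [f2 6 (by omega)]) (f2 9 (by omega)) fun i _ => f2 _ (by omega)
  have hidx : (indexExp k fun i => .get 10 (.lit i)).eval σ₁ = stateIndex e.dst :=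
    hprep.eval_indexExp hnew
  set σ₂ := σ₁.writeN 6 4 (stateIndex e.dst) with hσ₂
  have g1 : σ₂.real = σ.real := f1
  have g2 : ∀ b x, b ≠ 10 → b ≠ 6 ∨ x ≠ 4 → σ₂.num b x = σ.num b x := by
    intro b x hb hbx
    rw [hσ₂, State.writeN_num, if_neg (by tauto), f2 b hb]
  have g3 : σ₂.num 6 4 = stateIndex e.dst := by simp [hσ₂]
  have q2 : σ₂.num 6 2 = j := g2 6 2 (by omega) (by omega)
  have q3 : σ₂.num 6 3 = a := (g2 6 3 (by omega) (by omega)).trans ha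
  have g4 : ∀ i : Fin k, σ₂.num 10 i = e.dst i := fun i => by simp [hσ₂, hnew]
  have hτ : (relax k).exec σ = if noGain.holds σ₂ then σ₂ else (update k).exec σ₂ := by
    simp only [relax, Program.exec, if_pos hmove, ← hσ₁, hidx, NExp.eval, ← hσ₂]
  have hgain : noGain.holds σ₂ ↔ ReachedAt σ e.dst (σ.real 1 j + I.c a) := by
    simp only [noGain, newDist, Test.holds, NExp.eval, RExp.eval, var, g1, g3, q2, q3,
      g2 7 (stateIndex e.dst) (by omega) (by omega), hcost, not_lt, ReachedAt]
  by_cases hg : noGain.holds σ₂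
  · rw [hτ, if_pos hg]
    refine ⟨fun b _ _ hb _ x hx => g2 b x hb hx, by rw [g1], .inl ⟨fun j => ?_, ?_⟩⟩
    · exact ⟨g2 _ _ (by omega) (by omega), by rw [g1], g2 _ _ (by omega) (by omega),
        fun i _ => g2 _ _ (by omega) (by omega)⟩
    · intro e' he' hs' _
      rw [huniq e' he' hs']
      exact hgain.1 hg
  · rw [hτ, if_neg hg]
    have hup : (update k).exec σ₂ = (setCoords k fun i => .get 10 (.lit i)).exec
        (((σ₂.writeN 7 (stateIndex e.dst) 1).writeR 1 (stateIndex e.dst)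
          (σ.real 1 j + I.c a)).writeN 8 (stateIndex e.dst) (σ.num 8 j + 2 ^ (a : ℕ))) := by
      have p1 : σ₂.num 8 j = σ.num 8 j := g2 8 j (by omega) (by omega)
      have p2 : σ₂.num 9 a = 2 ^ (a : ℕ) :=
        (g2 9 a (by omega) (by omega)).trans (hσ.powers a a.2)
      simp [update, newDist, Program.exec, g1, g3, q2, q3, hcost, p1, p2]
    rw [hup]
    set σ₃ := ((σ₂.writeN 7 (stateIndex e.dst) 1).writeR 1 (stateIndex e.dst)
          (σ.real 1 j + I.c a)).writeN 8 (stateIndex e.dst) (σ.num 8 j + 2 ^ (a : ℕ)) with hσ₃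
    have k4 : σ₃.num 6 4 = stateIndex e.dst := by simp [hσ₃, g3]
    obtain ⟨h1, h2, h3⟩ := exec_setCoords k (fun i => .get 10 (.lit i)) σ₃
      fun i τ h => by simp [h 10 (by omega)]
    rw [k4] at h2 h3
    have k10 : ∀ i : Fin k, σ₃.num 10 i = e.dst i := fun i => by simp [hσ₃, g4]
    refine ⟨fun b h7 h8 h10 hc x hx => ?_, ?_, .inr ⟨e, rfl, hQ.index, hr, fun j' hj' => ?_, ?_, ?_,
      ?_, fun i => ?_, hgain.not.1 hg⟩⟩
    · rw [h2 b x (.inl hc)]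
      simp [hσ₃, h7, h8, g2 b x h10 hx]
    · rw [h1]
      funext x
      simp [hσ₃, g1]
    · refine ⟨?_, ?_, ?_, fun i hi => ?_⟩
      · rw [h2 _ _ (.inr hj')]; simp [hσ₃, hj', g2]
      · rw [h1]; simp [hσ₃, hj', g1]
      · rw [h2 _ _ (.inr hj')]; simp [hσ₃, hj', g2]
      · rw [h2 _ _ (.inr hj')]
        simp only [hσ₃, State.writeN_num, State.writeR_num, hj', and_false, if_false]
        exact g2 _ _ (by omega) (by omega)
    · rw [h2 _ _ (.inl fun i _ => by omega)]; simp [hσ₃]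
    · rw [h1]; simp [hσ₃]
    · rw [h2 _ _ (.inl fun i _ => by omega)]; simp [hσ₃]
    · rw [h3 i i.2]; exact k10 i

theorem ReachedAt.congr {σ τ : State} {u : Fin k → Fin n} {γ : ℝ} (h : ReachedAt σ u γ)
    (hj : SameRow k σ τ (stateIndex u)) : ReachedAt τ u γ := by
  rwa [ReachedAt, hj.reached, hj.dist]

theorem ReachedAt.mono {σ : State} {u : Fin k → Fin n} {γ δ : ℝ} (h : ReachedAt σ u γ)
    (hγ : γ ≤ δ) : ReachedAt σ u δ := ⟨h.1, h.2.trans hγ⟩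

theorem auxCost_concat (Q : List I.AuxArc) (e : I.AuxArc) :
    I.auxCost (Q ++ [e]) = I.auxCost Q + I.c e.arc := by simp [auxCost]

theorem prepared_relax {σ : State} (hσ : Prepared I σ) (hS : Sound I σ) {a : Fin m}
    (ha : σ.num 6 3 = a) : Prepared I ((relax k).exec σ) := by
  obtain ⟨h1, h2, -⟩ := exec_relax hσ hS ha
  refine hσ.congr (fun b hb => funext fun x => ?_) h2 ?_ (funext fun x => ?_)
    fun i _ => funext fun x => ?_ <;>
  exact h1 _ (by omega) (by omega) (by omega) (fun i _ => by omega) _ (by omega)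

theorem sound_relax {σ : State} (hσ : Prepared I σ) (hS : Sound I σ) {a : Fin m}
    (ha : σ.num 6 3 = a) : Sound I ((relax k).exec σ) := by
  obtain ⟨-, -, ⟨h, -⟩ | ⟨e, he, hes, hr, h, h7, hd, h8, hc, -⟩⟩ := exec_relax hσ hS ha
  · intro j hj
    rw [(h j).reached] at hj
    obtain ⟨u, Q, hQ⟩ := hS j hj
    exact ⟨u, Q, hQ.congr (h j)⟩
  · intro j hj
    by_cases hje : j = stateIndex e.dst
    · obtain ⟨u, Q, hQ⟩ := hS _ hr
      obtain rfl : e.src = u := stateIndex_injective (hes.trans hQ.index.symm)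
      rw [hje]
      refine ⟨e.dst, Q ++ [e], rfl, MultiDigraph.isWalk_append.2 ⟨_, hQ.walk, rfl, rfl⟩, hc, ?_, ?_⟩
      · rw [hd, auxCost_concat, hQ.dist, he]
      · rw [h8, hQ.mask, ← he]
        simp
    · rw [(h j hje).reached] at hj
      obtain ⟨u, Q, hQ⟩ := hS j hj
      exact ⟨u, Q, hQ.congr (h j hje)⟩

theorem reachedAt_relax {σ : State} (hσ : Prepared I σ) (hS : Sound I σ) {a : Fin m}
    (ha : σ.num 6 3 = a) {u : Fin k → Fin n} {γ : ℝ} (hu : ReachedAt σ u γ) :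
    ReachedAt ((relax k).exec σ) u γ := by
  obtain ⟨-, -, ⟨h, -⟩ | ⟨e, he, hes, hr, h, h7, hd, h8, hc, hn⟩⟩ := exec_relax hσ hS ha
  · exact hu.congr (h _)
  · by_cases hje : stateIndex u = stateIndex e.dst
    · obtain rfl := stateIndex_injective hje
      refine ⟨by omega, ?_⟩
      by_contra hlt
      rw [hd, not_le] at hlt
      exact hn (hu.mono hlt.le)
    · exact hu.congr (h _ hje)

theorem reachedAt_relax_concat {σ : State} (hσ : Prepared I σ) (hS : Sound I σ) {e : I.AuxArc}
    (ha : σ.num 6 3 = e.arc) (hs : σ.num 6 2 = stateIndex e.src) {γ : ℝ}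
    (hu : ReachedAt σ e.src γ) : ReachedAt ((relax k).exec σ) e.dst (γ + I.c e.arc) := by
  rw [ReachedAt, ← hs] at hu
  have hle := add_le_add_left hu.2 (I.c e.arc)
  obtain ⟨-, -, ⟨h, h'⟩ | ⟨e', he, hes, hr, h, h7, hd, -⟩⟩ := exec_relax hσ hS ha
  · exact ((h' e rfl hs.symm hu.1).mono hle).congr (h _)
  · rw [← AuxArc.dst_eq he (stateIndex_injective (hes.trans hs))]
    exact ⟨by omega, hd.trans_le hle⟩

/-- The state of affairs in round `r` of the search, after all arcs have been relaxed in the states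
before `j` and the arcs before `a` have been relaxed in the state `j`: all walks of at most `r` arcs
have been taken into account, and those of their extensions by one arc for which this arc has been
relaxed. -/
structure SearchInv (I : ExactSimDipaths k (Fin n) (Fin m)) (r j a : ℕ) (σ : State) : Prop where
  prepared : Prepared I σ
  sound : Sound I σ
  short : ∀ Q u, I.aux.IsWalk (fun _ => I.s) Q u → Q.length ≤ r → ReachedAt σ u (I.auxCost Q)
  extended : ∀ Q (e : I.AuxArc), I.aux.IsWalk (fun _ => I.s) Q e.src → Q.length ≤ r →
    stateIndex e.src < j ∨ stateIndex e.src = j ∧ (e.arc : ℕ) < a →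
    ReachedAt σ e.dst (I.auxCost Q + I.c e.arc)

/-- The invariants do not refer to the counters of the loops. -/
theorem SearchInv.writeN {r j a : ℕ} {σ : State} (h : SearchInv I r j a σ) {c : ℕ} (hc : c ≠ 0)
    (v : ℕ) : SearchInv I r j a (σ.writeN 6 c v) := by
  have hrow : ∀ j, SameRow k σ (σ.writeN 6 c v) j := fun j =>
    ⟨by simp, rfl, by simp, fun i _ => by simp [show 12 + 2 * i ≠ 6 by omega]⟩
  refine ⟨h.prepared.congr (fun b hb => ?_) rfl ?_ ?_ fun i _ => ?_, fun j hj => ?_, ?_, ?_⟩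
  · funext x; simp [show b ≠ 6 by omega]
  · simp [hc.symm]
  · funext x; simp
  · funext x; simp [show 11 + 2 * i ≠ 6 by omega]
  · obtain ⟨u, Q, hQ⟩ := h.sound j (by simpa using hj)
    exact ⟨u, Q, hQ.congr (hrow j)⟩
  · exact fun Q u hQ hr => (h.short Q u hQ hr).congr (hrow _)
  · exact fun Q e hQ hr he => (h.extended Q e hQ hr he).congr (hrow _)

theorem SearchInv.next_arc {r j a : ℕ} {σ : State} (h : SearchInv I r j a σ) (hj : σ.num 6 2 = j)
    (ha : σ.num 6 3 = a) (ham : a < m) : SearchInv I r j (a + 1) ((relax k).exec σ) := by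
  have ha' : σ.num 6 3 = (⟨a, ham⟩ : Fin m) := ha
  refine ⟨prepared_relax h.prepared h.sound ha', sound_relax h.prepared h.sound ha',
    fun Q u hQ hr => reachedAt_relax h.prepared h.sound ha' (h.short Q u hQ hr), ?_⟩
  intro Q e hQ hr he
  by_cases hnew : stateIndex e.src = j ∧ (e.arc : ℕ) = a
  · exact reachedAt_relax_concat h.prepared h.sound (ha.trans hnew.2.symm) (hj.trans hnew.1.symm)
      (h.short Q _ hQ hr)
  · exact reachedAt_relax h.prepared h.sound ha' (h.extended Q e hQ hr (by omega))

theorem SearchInv.next_state {r j : ℕ} {σ : State} (h : SearchInv I r j m σ) :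
    SearchInv I r (j + 1) 0 σ :=
  ⟨h.prepared, h.sound, h.short, fun Q e hQ hr he =>
    h.extended Q e hQ hr (by have := e.arc.2; omega)⟩

theorem SearchInv.next_round {r : ℕ} {σ : State} (h : SearchInv I r (n ^ k) 0 σ) :
    SearchInv I (r + 1) 0 0 σ := by
  refine ⟨h.prepared, h.sound, fun Q u hQ hr => ?_, fun Q e _ _ he => by omega⟩
  rcases List.eq_nil_or_concat Q with rfl | ⟨Q, e, rfl⟩
  · exact h.short [] u hQ (by simp)
  · simp only [List.concat_eq_append] at hQ hr ⊢
    obtain ⟨w, hQ', hw, hu⟩ := MultiDigraph.isWalk_append.1 hQ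
    obtain rfl : e.src = w := hw
    obtain rfl : e.dst = u := hu
    rw [auxCost_concat]
    exact h.extended Q e hQ' (by simpa using hr) (.inl (stateIndex_lt _))

/-! ### Correctness of the phases of the algorithm -/


theorem triple_search : Triple (SearchInv I 0 0 0) (search k)
    (loopCost 2 m (loopCost 2 (n ^ k) (loopCost 2 m (relax k).cost))) (SearchInv I m 0 0) := by
  have h1 : ∀ r j : ℕ, Triple (fun σ => SearchInv I r j 0 σ ∧ σ.num 6 1 = r ∧ σ.num 6 2 = j)
      (.forLoop 3 (.get 0 (.lit 1)) (relax k)) (loopCost 2 m (relax k).cost)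
      fun σ => SearchInv I r j m σ ∧ σ.num 6 1 = r ∧ σ.num 6 2 = j := by
    intro r j
    refine (Triple.forLoop (P := fun a σ => SearchInv I r j a σ ∧ σ.num 6 1 = r ∧ σ.num 6 2 = j ∧
      σ.num 6 3 = a) ?_ ?_ ?_).weaken (fun _ h => h) fun σ h => ⟨h.1, h.2.1, h.2.2.1⟩
    · rintro σ ⟨h, hr, hj⟩
      exact ⟨h.writeN (by omega) _, by simpa using hr, by simpa using hj, by simp⟩
    · rintro a σ ⟨h, -, -, ha⟩
      exact ⟨ha, h.prepared.m_eq⟩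
    · intro a ha
      refine Triple.of_loopFree (loopFree_relax k) ?_
      rintro σ ⟨h, hr, hj, hσa⟩
      have hf : ∀ x ≠ 4, ((relax k).exec σ).num 6 x = σ.num 6 x := fun x hx =>
        (exec_relax h.prepared h.sound (a := ⟨a, ha⟩) hσa).1 6 (by omega) (by omega) (by omega)
          (fun i _ => by omega) x (.inr hx)
      exact ⟨(h.next_arc hj hσa ha).writeN (by omega) _, by simp [hf, hr], by simp [hf, hj],
        by simp [hf, hσa]⟩
  have h2 : ∀ r : ℕ, Triple (fun σ => SearchInv I r 0 0 σ ∧ σ.num 6 1 = r)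
      (.forLoop 2 (var 0) (.forLoop 3 (.get 0 (.lit 1)) (relax k)))
      (loopCost 2 (n ^ k) (loopCost 2 m (relax k).cost))
      fun σ => SearchInv I r (n ^ k) 0 σ ∧ σ.num 6 1 = r := by
    intro r
    refine (Triple.forLoop (P := fun j σ => SearchInv I r j 0 σ ∧ σ.num 6 1 = r ∧
      σ.num 6 2 = j) ?_ ?_ ?_).weaken (fun _ h => h) fun σ h => ⟨h.1, h.2.1⟩
    · rintro σ ⟨h, hr⟩
      exact ⟨h.writeN (by omega) _, by simpa using hr, by simp⟩
    · rintro j σ ⟨h, -, hj⟩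
      exact ⟨hj, h.prepared.size⟩
    · intro j _
      refine (h1 r j).weaken (fun _ h => h) ?_
      rintro σ ⟨h, hr, hj⟩
      exact ⟨h.next_state.writeN (by omega) _, by simpa using hr, by simpa using hj⟩
  refine (Triple.forLoop (P := fun r σ => SearchInv I r 0 0 σ ∧ σ.num 6 1 = r) ?_ ?_
    ?_).weaken (fun _ h => h) fun σ h => h.1
  · intro σ h
    exact ⟨h.writeN (by omega) _, by simp⟩
  · rintro r σ ⟨h, hr⟩
    exact ⟨hr, h.prepared.m_eq⟩
  · intro r _
    refine (h2 r).weaken (fun _ h => h) ?_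
    rintro σ ⟨h, hr⟩
    exact ⟨h.next_round.writeN (by omega) _, by simpa using hr⟩

/-- The tables of multiples of `1, n, …, n ^ (i - 1)` are complete, and the variable 0 holds the
next power. No state has been reached. -/
structure Filled (I : ExactSimDipaths k (Fin n) (Fin m)) (i : ℕ) (σ : State) : Prop where
  input : ∀ b < 4, σ.num b = I.input.num b
  cost : σ.real 0 = I.input.real 0
  unreached : ∀ j, σ.num 7 j = 0
  size : σ.num 6 0 = n ^ i
  multiples : ∀ i' < i, ∀ x < n, σ.num (11 + 2 * i') x = x * n ^ i'

theorem Filled.congr {i : ℕ} {σ τ : State} (h : Filled I i σ) (h₀ : ∀ b < 4, τ.num b = σ.num b)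
    (h₁ : τ.real = σ.real) (h₂ : τ.num 7 = σ.num 7) (h₃ : τ.num 6 0 = σ.num 6 0)
    (h₄ : ∀ i' < i, τ.num (11 + 2 * i') = σ.num (11 + 2 * i')) : Filled I i τ where
  input b hb := by rw [h₀ b hb, h.input b hb]
  cost := by rw [h₁, h.cost]
  unreached j := by rw [h₂, h.unreached]
  size := by rw [h₃, h.size]
  multiples i' hi x hx := by rw [h₄ i' hi, h.multiples i' hi x hx]

theorem Filled.writeN {i : ℕ} {σ : State} (h : Filled I i σ) {b j : ℕ} (v : ℕ)
    (hb : b = 6 ∧ j ≠ 0 ∨ b = 9 ∨ ∃ i' ≥ i, b = 11 + 2 * i') : Filled I i (σ.writeN b j v) := by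
  have hne : ∀ b' x, (b' < 4 ∨ b' = 7 ∨ (b' = 6 ∧ x = 0) ∨ ∃ i' < i, b' = 11 + 2 * i') →
      (σ.writeN b j v).num b' x = σ.num b' x := by
    intro b' x hb'
    rw [State.writeN_num, if_neg]
    rintro ⟨rfl, rfl⟩
    rcases hb with hb | hb | ⟨i', hi, hb⟩ <;> rcases hb' with hb' | hb' | hb' | ⟨i'', hi', hb'⟩ <;>
      omega
  refine h.congr (fun b' hb' => ?_) rfl ?_ (hne 6 0 (by tauto)) fun i' hi' => ?_
  · exact funext fun x => hne b' x (by tauto)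
  · exact funext fun x => hne 7 x (by tauto)
  · exact funext fun x => hne _ x (.inr (.inr (.inr ⟨i', hi', rfl⟩)))

theorem Filled.n_eq {i : ℕ} {σ : State} (h : Filled I i σ) : σ.num 0 0 = n :=
  h.input 0 (by omega) ▸ rfl

theorem Filled.m_eq {i : ℕ} {σ : State} (h : Filled I i σ) : σ.num 0 1 = m :=
  h.input 0 (by omega) ▸ rfl

theorem filled_input : Filled I 0 (I.input.writeN 6 0 1) where
  input b hb := by funext x; simp [show b ≠ 6 by omega]
  cost := rfl
  unreached j := by simp [ExactSimDipaths.input]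
  size := by simp
  multiples := by simp

theorem triple_makeMultiples : Triple (fun σ => σ = I.input) (makeMultiples k)
    (3 + (k * (3 + (loopCost 2 n 11 + 5)) + 1)) (Filled I k) := by
  refine Triple.seq (Q := Filled I 0) ?_ (Triple.unroll fun i hi => ?_)
  · refine Triple.of_loopFree (by trivial) ?_
    rintro σ rfl
    exact filled_input
  · refine Triple.seq (Q := fun σ => Filled I i σ ∧ σ.num (11 + 2 * i) 0 = 0) ?_
      (Triple.seq (Q := fun σ => Filled I i σ ∧ ∀ y ≤ n, σ.num (11 + 2 * i) y = y * n ^ i) ?_ ?_)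
    · refine Triple.of_loopFree (by trivial) fun σ h => ⟨h.writeN _ ?_, ?_⟩
      · exact .inr (.inr ⟨i, le_rfl, rfl⟩)
      · simp [Program.exec]
    · refine (Triple.forLoop (P := fun x σ => Filled I i σ ∧
        (∀ y ≤ x, σ.num (11 + 2 * i) y = y * n ^ i) ∧ σ.num 6 5 = x) ?_ ?_ ?_).weaken
        (fun _ h => h) fun σ h => ⟨h.1, h.2.1⟩
      · rintro σ ⟨h, h0⟩
        refine ⟨h.writeN _ (by omega), fun y hy => ?_, by simp⟩
        obtain rfl : y = 0 := by omega
        simpa [show 11 + 2 * i ≠ 6 by omega] using h0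
      · rintro x σ ⟨h, -, hx⟩
        exact ⟨hx, h.n_eq⟩
      · intro x hx
        refine Triple.of_loopFree (by trivial) ?_
        rintro σ ⟨h, ht, h5⟩
        refine ⟨(h.writeN _ ?_).writeN _ (by omega), fun y hy => ?_, ?_⟩
        · exact .inr (.inr ⟨i, le_rfl, rfl⟩)
        · rcases Nat.le_succ_iff_eq_or_le.1 hy with rfl | hy
          · simp [Program.exec, h5, ht x le_rfl, h.size, add_mul, show 11 + 2 * i ≠ 6 by omega]
          · simp [Program.exec, h5, ht y hy, show y ≠ x + 1 by omega,
              show 11 + 2 * i ≠ 6 by omega]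
        · simp [Program.exec, h5, show 6 ≠ 11 + 2 * i by omega]
    · refine Triple.of_loopFree (by trivial) ?_
      rintro σ ⟨h, ht⟩
      have hw : ∀ b x, b ≠ 6 → (σ.writeN 6 0 (n ^ (i + 1))).num b x = σ.num b x :=
        fun b x hb => by simp [hb]
      have hexec : Program.exec (.setN 6 (.lit 0) (.get (11 + 2 * i) (.get 0 (.lit 0)))) σ =
          σ.writeN 6 0 (n ^ (i + 1)) := by
        simp [Program.exec, h.n_eq, ht n le_rfl, pow_succ']
      rw [hexec]
      refine ⟨fun b hb => ?_, h.cost, fun j => ?_, by simp, fun i' hi' x hx => ?_⟩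
      · rw [← h.input b hb]
        exact funext fun x => hw b x (by omega)
      · rw [hw _ _ (by omega), h.unreached]
      · rw [hw _ _ (by omega)]
        rcases Nat.lt_succ_iff_lt_or_eq.1 hi' with hi' | rfl
        · exact h.multiples i' hi' x hx
        · exact ht x hx.le

theorem triple_makePowers : Triple (Filled I k) makePowers (3 + loopCost 2 m 12)
    fun σ => Prepared I σ ∧ ∀ j, σ.num 7 j = 0 := by
  refine Triple.weaken (P := Filled I k) (Q := fun σ => Filled I k σ ∧ ∀ y ≤ m, σ.num 9 y = 2 ^ y)
    (Triple.seq (Q := fun σ => Filled I k σ ∧ σ.num 9 0 = 1) ?_ ?_) (fun _ h => h) ?_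
  · refine Triple.of_loopFree (by trivial) fun σ h => ⟨h.writeN _ (by omega), ?_⟩
    simp [Program.exec]
  · refine (Triple.forLoop (P := fun x σ => Filled I k σ ∧ (∀ y ≤ x, σ.num 9 y = 2 ^ y) ∧
      σ.num 6 5 = x) ?_ ?_ ?_).weaken (fun _ h => h) fun σ h => ⟨h.1, h.2.1⟩
    · rintro σ ⟨h, h0⟩
      exact ⟨h.writeN _ (by omega), by simpa using h0, by simp⟩
    · rintro x σ ⟨h, -, hx⟩
      exact ⟨hx, h.m_eq⟩
    · intro x hx
      refine Triple.of_loopFree (by trivial) ?_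
      rintro σ ⟨h, h9, h5⟩
      refine ⟨(h.writeN _ (by omega)).writeN _ (by omega), fun y hy => ?_, ?_⟩
      · rcases Nat.le_succ_iff_eq_or_le.1 hy with rfl | hy
        · simp [Program.exec, h5, h9 x le_rfl, pow_succ, mul_two]
        · simp [Program.exec, h5, h9 y hy, show y ≠ x + 1 by omega]
      · simp [Program.exec, h5]
  · rintro σ ⟨h, h9⟩
    exact ⟨⟨h.input, h.cost, h.size, h.multiples, fun a ha => h9 a ha.le⟩, h.unreached⟩

theorem triple_initTable : Triple (fun σ => Prepared I σ ∧ ∀ j, σ.num 7 j = 0) (initTable k)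
    (initTable k).cost (SearchInv I 0 0 0) := by
  refine Triple.of_loopFree (loopFree_initTable k) ?_
  rintro σ ⟨hσ, h7⟩
  set z := stateIndex (fun _ : Fin k => I.s) with hz
  have hidx : (indexExp k fun _ => .get 0 (.lit 2)).eval σ = z :=
    hσ.eval_indexExp fun _ => hσ.s_eq
  have hexec : (initTable k).exec σ = (setCoords k fun _ => .get 0 (.lit 2)).exec
      ((((σ.writeN 6 4 z).writeN 7 z 1).writeN 8 z 0).writeR 1 z 0) := by
    simp [initTable, Program.exec, hidx]
  rw [hexec]
  set σ₁ := (((σ.writeN 6 4 z).writeN 7 z 1).writeN 8 z 0).writeR 1 z 0 with hσ₁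
  obtain ⟨h1, h2, h3⟩ := exec_setCoords k (fun _ => .get 0 (.lit 2)) σ₁
    fun i τ h => by simp [h 0 (by omega)]
  rw [show σ₁.num 6 4 = z by simp [hσ₁]] at h2 h3
  set τ := (setCoords k fun _ => .get 0 (.lit 2)).exec σ₁
  have h7' : ∀ j, τ.num 7 j = if j = z then 1 else 0 := by
    intro j
    rw [h2 7 j (.inl fun i _ => by omega)]
    simp [hσ₁, h7]
  have hdist : τ.real 1 z = 0 := by rw [h1]; simp [hσ₁]
  refine ⟨hσ.congr (fun b hb => ?_) ?_ ?_ ?_ fun i _ => ?_, fun j hj => ?_, fun Q u hQ hr => ?_,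
    fun Q e _ _ he => by omega⟩
  · funext x
    rw [h2 b x (.inl fun i _ => by omega)]
    simp [hσ₁, show b ≠ 6 by omega, show b ≠ 7 by omega, show b ≠ 8 by omega]
  · rw [h1]; funext x; simp [hσ₁]
  · rw [h2 6 0 (.inl fun i _ => by omega)]; simp [hσ₁]
  · funext x; rw [h2 9 x (.inl fun i _ => by omega)]; simp [hσ₁]
  · funext x
    rw [h2 _ x (.inl fun i _ => by omega)]
    simp [hσ₁, show 11 + 2 * i ≠ 6 by omega, show 11 + 2 * i ≠ 7 by omega,
      show 11 + 2 * i ≠ 8 by omega]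
  · obtain rfl : j = z := by
      rw [h7'] at hj
      by_contra h
      simp [h] at hj
    refine ⟨_, [], rfl, rfl, fun i => ?_, hdist, ?_⟩
    · rw [h3 i i.2, ← hσ.s_eq]
      simp [hσ₁]
    · rw [h2 8 _ (.inl fun i _ => by omega)]; simp [hσ₁]
  · obtain rfl : Q = [] := List.eq_nil_of_length_eq_zero (by omega)
    obtain rfl : (fun _ => I.s) = u := hQ
    exact ⟨by rw [h7', if_pos rfl]; exact one_pos, hdist.le⟩

/-- The invariant of the decoding is that the remaining number is the bit mask of the part of the
set below the arcs that have already been considered. -/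
theorem triple_decode (A' : Finset (Fin m)) :
    Triple (fun σ => σ.num 0 1 = m ∧ (∀ a < m, σ.num 9 a = 2 ^ a) ∧ σ.num 4 0 = 1 ∧
        σ.num 6 4 = ∑ a ∈ A', 2 ^ (a : ℕ)) decode (loopCost 2 m 42)
      fun σ => σ.num 4 0 = 1 ∧ output m σ = A' := by
  refine (Triple.forLoop (P := fun x σ => σ.num 0 1 = m ∧ (∀ a < m, σ.num 9 a = 2 ^ a) ∧
    σ.num 4 0 = 1 ∧ σ.num 6 4 = ∑ a ∈ A' with a.1 + x < m, 2 ^ (a : ℕ) ∧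
    (∀ a : Fin m, m ≤ a + x → (σ.num 5 a = 1 ↔ a ∈ A')) ∧ σ.num 6 5 = x) ?_ ?_ ?_).weaken
    (fun _ h => h) ?_
  · rintro σ ⟨hm, h9, h4, hx⟩
    refine ⟨by simpa using hm, by simpa using h9, by simpa using h4, ?_, fun a ha => by omega,
      by simp⟩
    simp [hx]
  · rintro x σ ⟨hm, -, -, -, -, hx⟩
    exact ⟨hx, hm⟩
  · intro x hx
    refine Triple.of_loopFree (by trivial) ?_
    rintro σ ⟨hm, h9, h4, hsum, h5, hσx⟩
    obtain ⟨a, ha⟩ : ∃ a : Fin m, a.1 + x + 1 = m := ⟨⟨m - (x + 1), by omega⟩, by simp; omega⟩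
    have hdec : decodeArc.eval σ = a := by
      simp only [decodeArc, NExp.eval, var, hm, hσx]
      omega
    -- the part of the sum that belongs to the arcs before `a` is less than `2 ^ a`
    have hlt : ∑ b ∈ A' with b.1 + (x + 1) < m, 2 ^ (b : ℕ) < 2 ^ (a : ℕ) := by
      have := Nat.geomSum_lt (m := 2) (n := a)
        (s := (A'.filter fun b => b.1 + (x + 1) < m).map Fin.valEmbedding) le_rfl ?_
      · simpa using this
      · intro b hb
        obtain ⟨c, hc, rfl⟩ := Finset.mem_map.1 hb
        have := (Finset.mem_filter.1 hc).2
        simp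
        omega
    have hsplit : ∑ b ∈ A' with b.1 + x < m, 2 ^ (b : ℕ) =
        (if a ∈ A' then 2 ^ (a : ℕ) else 0) + ∑ b ∈ A' with b.1 + (x + 1) < m, 2 ^ (b : ℕ) := by
      split_ifs with haA
      · rw [← Finset.sum_insert (f := fun b : Fin m => 2 ^ (b : ℕ))]
        · refine Finset.sum_congr (Finset.ext fun b => ?_) fun _ _ => rfl
          simp only [Finset.mem_filter, Finset.mem_insert, Fin.ext_iff]
          constructor
          · rintro ⟨h1, h2⟩
            by_cases hb : b.1 = a
            · exact .inl hb
            · exact .inr ⟨h1, by omega⟩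
          · rintro (hb | ⟨h1, h2⟩)
            · exact ⟨by rwa [Fin.ext hb], by omega⟩
            · exact ⟨h1, by omega⟩
        · simp
          omega
      · rw [zero_add]
        refine Finset.sum_congr (Finset.ext fun b => ?_) fun _ _ => rfl
        simp only [Finset.mem_filter]
        refine and_congr_right fun hb => ⟨fun h => ?_, fun h => by omega⟩
        have : b.1 ≠ a := fun h => haA (Fin.ext h ▸ hb)
        omega
    have htest : (Test.nlt (var 4) (.get 9 decodeArc)).holds σ ↔ a ∉ A' := by
      simp only [Test.holds, NExp.eval, var, hdec, h9 a a.2, hsum, hsplit]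
      split_ifs with h
      · simp [h]
      · simpa [h] using hlt
    have hlast : ∀ b : Fin m, m ≤ b.1 + (x + 1) → b ≠ a → m ≤ b.1 + x := by
      intro b hb hne
      have : b.1 ≠ a := fun h => hne (Fin.ext h)
      omega
    by_cases haA : a ∈ A'
    · have hexec : (Program.ite (.nlt (var 4) (.get 9 decodeArc)) (.setN 5 decodeArc (.lit 0))
          (.seq (.setN 6 (.lit 4) (.sub (var 4) (.get 9 decodeArc)))
            (.setN 5 decodeArc (.lit 1)))).exec σ =
          (σ.writeN 6 4 (∑ b ∈ A' with b.1 + (x + 1) < m, 2 ^ (b : ℕ))).writeN 5 a 1 := by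
        have hd' : ∀ v, decodeArc.eval (σ.writeN 6 4 v) = a := fun v => by
          rw [← hdec]
          simp [decodeArc]
        have hs : σ.num 6 4 - 2 ^ (a : ℕ) = ∑ b ∈ A' with b.1 + (x + 1) < m, 2 ^ (b : ℕ) := by
          rw [hsum, hsplit, if_pos haA, Nat.add_sub_cancel_left]
        rw [Program.exec, if_neg (by rw [htest]; exact not_not_intro haA)]
        simp only [Program.exec, NExp.eval, hd', hdec, var, h9 a a.2, hs]
      rw [hexec]
      refine ⟨by simpa using hm, by simpa using h9, by simpa using h4, by simp, fun b hb => ?_,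
        by simp [hσx]⟩
      by_cases hba : b = a
      · simp [hba, haA]
      · simpa [hba, Fin.val_inj] using h5 b (hlast b hb hba)
    · have hexec : (Program.ite (.nlt (var 4) (.get 9 decodeArc)) (.setN 5 decodeArc (.lit 0))
          (.seq (.setN 6 (.lit 4) (.sub (var 4) (.get 9 decodeArc)))
            (.setN 5 decodeArc (.lit 1)))).exec σ = σ.writeN 5 a 0 := by
        rw [Program.exec, if_pos (htest.2 haA)]
        simp only [Program.exec, NExp.eval, hdec]
      rw [hexec]
      refine ⟨by simpa using hm, by simpa using h9, by simpa using h4, ?_, fun b hb => ?_,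
        by simp [hσx]⟩
      · rw [if_neg haA, zero_add] at hsplit
        simp [hsum, hsplit]
      · by_cases hba : b = a
        · simp [hba, haA]
        · simpa [hba, Fin.val_inj] using h5 b (hlast b hb hba)
  · rintro σ ⟨-, -, h4, -, h5, -⟩
    refine ⟨h4, Finset.ext fun a => ?_⟩
    simp [output, h5 a (by omega)]

theorem triple_answer (hD : I.D.IsAcyclic) : Triple (SearchInv I m 0 0) (answer k)
    ((Program.setN 6 (.lit 4) (indexExp k fun _ => .get 0 (.lit 3))).cost +
      (5 + (3 + (5 + loopCost 2 m 42)) + 3)) I.IsSolvedBy := by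
  set z := stateIndex (fun _ : Fin k => I.t) with hz
  have hopt : ∀ {σ}, SearchInv I m 0 0 σ → ∀ B, I.IsFeasible B →
      ReachedAt σ (fun _ : Fin k => I.t) (I.cost B) := by
    intro σ hσ B hB
    obtain ⟨P, hP, -, hc⟩ := exists_isWalk_of_feasible hD hB
    exact hc ▸ hσ.short P _ hP (length_le_of_isWalk hD hP)
  refine Triple.seq (Q := fun σ => SearchInv I m 0 0 σ ∧ σ.num 6 4 = z) ?_ (Triple.ite ?_ ?_)
  · refine Triple.of_loopFree (by trivial) fun σ h => ?_
    have hidx : (indexExp k fun _ => .get 0 (.lit 3)).eval σ = z :=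
      h.prepared.eval_indexExp fun _ => h.prepared.t_eq
    have hexec : Program.exec (.setN 6 (.lit 4) (indexExp k fun _ => .get 0 (.lit 3))) σ =
        σ.writeN 6 4 z := by
      simp only [Program.exec, NExp.eval, hidx]
    rw [hexec]
    exact ⟨h.writeN (by omega) _, by simp⟩
  · rintro σ ⟨⟨h, h4⟩, hr⟩
    simp only [Test.holds, NExp.eval, var, h4] at hr
    obtain ⟨u, Q, hQ⟩ := h.sound z hr
    obtain rfl := stateIndex_injective hQ.index
    obtain ⟨A', hQA, hA, hcost⟩ := exists_feasible_of_isWalk hD hQ.walk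
    have hmask : σ.num 8 z = ∑ a ∈ A', 2 ^ (a : ℕ) := by
      have : A' = (Q.map AuxArc.arc).toFinset := Finset.ext fun a => by simp [hQA a]
      rw [hQ.mask, this, List.sum_toFinset _ (nodup_arc_of_isWalk hD hQ.walk), List.map_map]
      rfl
    have hmin : ∀ B, I.IsFeasible B → I.cost A' ≤ I.cost B := fun B hB => by
      rw [hcost, ← hQ.dist]
      exact (hopt h B hB).2
    have htriple : Triple (fun τ => τ = σ) (.seq (.setN 4 (.lit 0) (.lit 1))
        (.seq (.setN 6 (.lit 4) (.get 8 (var 4))) decode)) (3 + (5 + loopCost 2 m 42))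
        fun τ => τ.num 4 0 = 1 ∧ output m τ = A' := by
      refine Triple.seq (Q := fun τ => τ = σ.writeN 4 0 1) ?_
        (Triple.seq (Q := fun τ => τ = (σ.writeN 4 0 1).writeN 6 4 (∑ a ∈ A', 2 ^ (a : ℕ))) ?_
          ((triple_decode A').weaken ?_ fun _ h => h))
      · exact Triple.of_loopFree (by trivial) (by rintro τ rfl; rfl)
      · refine Triple.of_loopFree (by trivial) ?_
        rintro τ rfl
        simp [Program.exec, h4, hmask]
      · rintro τ rfl
        refine ⟨?_, fun a ha => ?_, by simp, by simp⟩
        · simpa using h.prepared.m_eq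
        · simpa using h.prepared.powers a ha
    obtain ⟨T, τ, hrun, hT, h1, hout⟩ := htriple σ rfl
    exact ⟨T, τ, hrun, hT, fun _ => ⟨h1, hout ▸ ⟨hA, hmin⟩⟩, fun hno => (hno ⟨A', hA⟩).elim⟩
  · refine Triple.of_loopFree (by trivial) ?_
    rintro σ ⟨⟨h, h4⟩, hr⟩
    refine ⟨fun ⟨B, hB⟩ => (hr ?_).elim, fun _ => by simp [Program.exec]⟩
    simp only [Test.holds, NExp.eval, var, h4]
    exact (hopt h B hB).1

/-- The polynomial is the sum of the bounds for the phases, which are read off from the shape of the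
programs. -/
theorem exists_polynomial_solve (k : ℕ) : ∃ p : Polynomial ℕ,
    ∀ (n m : ℕ) (I : ExactSimDipaths k (Fin n) (Fin m)), I.D.IsAcyclic →
      Triple (fun σ => σ = I.input) (solve k) (p.eval (n + m)) I.IsSolvedBy := by
  have hn := PolyBound.left
  have hm := PolyBound.right
  have hc := PolyBound.const
  obtain ⟨p, hp⟩ := ((hc 3).add (((hc k).mul ((hc 3).add ((hn.loopCost 2 (hc 11)).add
    (hc 5)))).add (hc 1))).add (((hc 3).add (hm.loopCost 2 (hc 12))).add
    ((hc (initTable k).cost).add ((hm.loopCost 2 ((hn.pow k).loopCost 2 (hm.loopCost 2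
      (hc (relax k).cost)))).add ((hc (Program.setN 6 (.lit 4)
        (indexExp k fun _ => .get 0 (.lit 3))).cost).add
          (((hc 5).add ((hc 3).add ((hc 5).add (hm.loopCost 2 (hc 42))))).add (hc 3))))))
  refine ⟨p, fun n m I hD σ hσ => ?_⟩
  obtain ⟨T, τ, hr, hT, hτ⟩ := triple_makeMultiples.seq (triple_makePowers.seq
    (triple_initTable.seq (triple_search.seq (triple_answer hD)))) σ hσ
  exact ⟨T, τ, hr, hT.trans (hp n m), hτ⟩

end ExactSimDipaths

theorem mainTheorem5 (k : ℕ) (hk : 0 < k) :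
    -- a polynomial-time algorithm for acyclic instances with `k` colors
    (∃ (P : RAM.Program) (p : Polynomial ℕ),
      ∀ (n m : ℕ) (I : ExactSimDipaths k (Fin n) (Fin m)), I.D.IsAcyclic →
        ∃ (T : ℕ) (τ : RAM.State),
          RAM.Runs P I.input T τ ∧ T ≤ p.eval (n + m) ∧ I.IsSolvedBy τ) ∧
    -- the correspondence between feasible solutions and dipaths of the auxiliary digraph
    (∀ (V A : Type*) [Finite V] [Finite A] (I : ExactSimDipaths k V A), I.D.IsAcyclic →
      (∀ Q, I.IsAuxDipath Q →
        ∃ A', I.Corresponds Q A' ∧ I.IsFeasible A' ∧ I.cost A' = I.auxCost Q) ∧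
      (∀ A', I.IsFeasible A' →
        ∃ Q, I.IsAuxDipath Q ∧ I.Corresponds Q A' ∧ I.auxCost Q = I.cost A') ∧
      (∀ γ : ℝ, (∃ A', I.IsFeasible A' ∧ I.cost A' = γ) ↔
        ∃ Q, I.IsAuxDipath Q ∧ I.auxCost Q = γ)) := by
  refine ⟨?_, fun V A _ _ I hD => ?_⟩
  · obtain ⟨p, hp⟩ := ExactSimDipaths.exists_polynomial_solve k
    exact ⟨RAM.solve k, p, fun n m I hD => hp n m I hD I.input rfl⟩
  · have h1 : ∀ Q, I.IsAuxDipath Q →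
        ∃ A', I.Corresponds Q A' ∧ I.IsFeasible A' ∧ I.cost A' = I.auxCost Q :=
      fun Q hQ => ExactSimDipaths.exists_feasible_of_isWalk hD hQ.1
    have h2 : ∀ A', I.IsFeasible A' →
        ∃ Q, I.IsAuxDipath Q ∧ I.Corresponds Q A' ∧ I.auxCost Q = I.cost A' := by
      intro A' hA
      obtain ⟨Q, hQ, hc⟩ := ExactSimDipaths.exists_isWalk_of_feasible hD hA
      exact ⟨Q, MultiDigraph.isDipath_of_no_closed
        (ExactSimDipaths.aux_closed_eq_nil hD) hQ, hc⟩
    refine ⟨h1, h2, fun γ => ⟨?_, ?_⟩⟩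
    · rintro ⟨A', hA, rfl⟩
      obtain ⟨Q, hQ, -, hc⟩ := h2 A' hA
      exact ⟨Q, hQ, hc⟩
    · rintro ⟨Q, hQ, rfl⟩
      obtain ⟨A', -, hA, hc⟩ := h1 Q hQ
      exact ⟨A', hA, hc⟩
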